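/- Let $M$ be a complex manifold of complex dimension $m$, let $f : M \to M$ be a holomorphic automorphism, and let $\tau \in \mathbb{C}$ with $\operatorname{Im}\tau > 0$. The group $\mathbb{Z}^2$ acts on $M \times \mathbb{C}$ by $$(1,0)\cdot(x,z) = (f(x), z+1), \qquad (0,1)\cdot(x,z) = (x, z+\tau),$$ and this action is free, properly discontinuous and holomorphic. The suspension $M_f$ is the quotient complex manifold $(M \times \mathbb{C})/\mathbb{Z}^2$, of complex dimension $m+1$. A Hermitian metric with fundamental form $\omega$ on a complex manifold of complex dimension $n$ is called balanced if $d(\omega^{n-1}) = 0$, and its volume form is $\omega^n/n!$. Proposition. Suppose that $M$ admits a balanced metric with fundamental form $\omega$ whose volume form is invariant under $f$, that is, $f^*(\omega^m) = \omega^m$. Then $M_f$ admits a balanced metric. -/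

import Mathlib

open scoped Manifold ContDiff Topology UpperHalfPlane

/-- A complex manifold is, with the same charts, a smooth real manifold. -/
instance IsManifold.real_of_complex {E : Type*} [NormedAddCommGroup E] [NormedSpace ℂ E]
    {X : Type*} [TopologicalSpace X] [ChartedSpace E X] [IsManifold 𝓘(ℂ, E) ω X] (n : ℕ∞ω) :
    IsManifold 𝓘(ℝ, E) n X := by
  refine isManifold_of_contDiffOn _ _ _ fun e e' he he' => ?_
  have h := (contDiffGroupoid ω 𝓘(ℂ, E)).compatible he he'
  rw [contDiffGroupoid, mem_groupoid_of_pregroupoid] at h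
  exact (ContDiffOn.restrict_scalars ℝ h.1).of_le le_top

section Forms

variable {V : Type*} [AddCommGroup V] [Module ℝ V] [TopologicalSpace V]

/-- The index `2 i + j`, for `i < k` and `j ∈ {0, 1}`. -/
def pairIndex {k : ℕ} (i : Fin k) (j : Fin 2) : Fin (2 * k) := ⟨2 * i + j, by omega⟩

theorem pairIndex_injective {k : ℕ} (i : Fin k) : Function.Injective (pairIndex i) := by
  intro j j' h
  simp only [pairIndex, Fin.mk.injEq] at h
  omega

theorem exists_pairIndex {k : ℕ} (c : Fin (2 * k)) : ∃ i j, pairIndex (k := k) i j = c :=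
  ⟨⟨c / 2, by omega⟩, ⟨c % 2, by omega⟩, by simp only [pairIndex, Fin.ext_iff]; omega⟩

theorem prod_pairIndex_update {k : ℕ} [DecidableEq (Fin (2 * k))] (α : V [⋀^Fin 2]→L[ℝ] ℝ)
    (v : Fin (2 * k) → V) (i : Fin k) (j : Fin 2) (x : V) :
    ∏ l, α (Function.update v (pairIndex i j) x ∘ pairIndex l) =
      α (Function.update (v ∘ pairIndex i) j x) *
        ∏ l ∈ Finset.univ.erase i, α (v ∘ pairIndex l) := by
  rw [← Finset.mul_prod_erase _ _ (Finset.mem_univ i)]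
  congr 1
  · rw [Function.update_comp_eq_of_injective _ (pairIndex_injective i)]
  · refine Finset.prod_congr rfl fun l hl => ?_
    rw [Function.update_comp_eq_of_notMem_range]
    rintro ⟨j', h⟩
    simp only [pairIndex, Fin.mk.injEq] at h
    exact (Finset.ne_of_mem_erase hl) (Fin.ext (by omega))

/-- The multilinear map `(v₀, …, v₂ₖ₋₁) ↦ α(v₀, v₁) α(v₂, v₃) ⋯ α(v₂ₖ₋₂, v₂ₖ₋₁)`, that is, the `k`-th
tensor power of the 2-form `α`. -/
def tensorPower (α : V [⋀^Fin 2]→L[ℝ] ℝ) (k : ℕ) :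
    ContinuousMultilinearMap ℝ (fun _ : Fin (2 * k) => V) ℝ where
  toFun v := ∏ i : Fin k, α (v ∘ pairIndex i)
  map_update_add' v c x y := by
    obtain ⟨i, j, rfl⟩ := exists_pairIndex c
    simp only [prod_pairIndex_update, ContinuousAlternatingMap.map_update_add, add_mul]
  map_update_smul' v c a x := by
    obtain ⟨i, j, rfl⟩ := exists_pairIndex c
    simp only [prod_pairIndex_update, ContinuousAlternatingMap.map_update_smul, smul_eq_mul,
      mul_assoc]
  cont := by
    refine continuous_finsetProd _ fun i _ => α.coe_continuous.comp ?_
    exact continuous_pi fun j => continuous_apply _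

/-- The `k`-th exterior power `α ∧ ⋯ ∧ α` of the 2-form `α`, which is the `2k`-form
`(v₀, …, v₂ₖ₋₁) ↦ 2⁻ᵏ ∑_σ sgn(σ) α(v_σ(0), v_σ(1)) ⋯ α(v_σ(2k-2), v_σ(2k-1))`, the sum being over the
permutations of the `2k` indices. This is the convention in which
`(dx ∧ dy)(v, w) = dx(v) dy(w) - dx(w) dy(v)`. -/
noncomputable def wedgePower (α : V [⋀^Fin 2]→L[ℝ] ℝ) (k : ℕ) : V [⋀^Fin (2 * k)]→L[ℝ] ℝ :=
  ((2 : ℝ) ^ k)⁻¹ • ContinuousMultilinearMap.alternatization (tensorPower α k)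

end Forms

section Manifold

variable {E : Type*} [NormedAddCommGroup E] [NormedSpace ℂ E]
  {X : Type*} [TopologicalSpace X] [ChartedSpace E X]

/-- The complex structure `J` on the real tangent space `T_x X` of a complex manifold. The real
tangent space is identified with `E` through the preferred holomorphic chart at `x`, and `J` is the
multiplication by `i` on `E`. -/
noncomputable def tangentJ (x : X) : TangentSpace 𝓘(ℝ, E) x →L[ℝ] TangentSpace 𝓘(ℝ, E) x :=
  ((Complex.I • ContinuousLinearMap.id ℂ E).restrictScalars ℝ : E →L[ℝ] E)

theorem tangentJ_tangentJ (x : X) (v : TangentSpace 𝓘(ℝ, E) x) :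
    tangentJ x (tangentJ x v) = -v := by
  have h (w : E) : Complex.I • Complex.I • w = -w := by
    rw [smul_smul, Complex.I_mul_I, neg_smul, one_smul]
  exact h v

variable (E X) in
/-- A differential `k`-form on the real manifold underlying `X`, as a family of alternating forms on
the tangent spaces; regularity is not part of this type. -/
abbrev FormFamily (k : ℕ) : Type _ := ∀ x : X, TangentSpace 𝓘(ℝ, E) x [⋀^Fin k]→L[ℝ] ℝ

/-- The expression of a differential form in the chart `e`, that is, its pullback under the inverse
of `e`; it is meaningful on the target of `e`. -/
noncomputable def FormFamily.inChart {k : ℕ} (α : FormFamily E X k) (e : OpenPartialHomeomorph X E)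
    (y : E) : E [⋀^Fin k]→L[ℝ] ℝ :=
  (α (e.symm y)).compContinuousLinearMap
    (mfderiv 𝓘(ℝ, E) 𝓘(ℝ, E) e.symm y : E →L[ℝ] TangentSpace 𝓘(ℝ, E) (e.symm y))

/-- A differential form is closed if it is differentiable with vanishing exterior derivative in
every chart of the atlas. -/
def FormFamily.IsClosed {k : ℕ} (α : FormFamily E X k) : Prop :=
  ∀ e ∈ atlas E X, DifferentiableOn ℝ (α.inChart e) e.target ∧
    ∀ y ∈ e.target, extDeriv (α.inChart e) y = 0

/-- A differential form is invariant under the map `f` if its pullback under `f` is itself. -/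
def FormFamily.IsInvariant {k : ℕ} (α : FormFamily E X k) (f : X → X) : Prop :=
  ∀ x, (α (f x)).compContinuousLinearMap (mfderiv 𝓘(ℝ, E) 𝓘(ℝ, E) f x) = α x

variable [IsManifold 𝓘(ℂ, E) ω X]

variable (E X) in
/-- A Hermitian metric on a complex manifold: a smooth Riemannian metric on the underlying real
manifold for which the complex structure `J` is orthogonal. -/
structure HermitianMetric extends Bundle.ContMDiffRiemannianMetric 𝓘(ℝ, E) ∞ E
    (fun x : X => TangentSpace 𝓘(ℝ, E) x) where
  inner_tangentJ (x : X) (v w : TangentSpace 𝓘(ℝ, E) x) :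
    inner x (tangentJ x v) (tangentJ x w) = inner x v w

namespace HermitianMetric

theorem inner_tangentJ_self (g : HermitianMetric E X) (x : X) (v : TangentSpace 𝓘(ℝ, E) x) :
    g.inner x (tangentJ x v) v = 0 := by
  have h := g.inner_tangentJ x (tangentJ x v) v
  rw [tangentJ_tangentJ, map_neg, neg_apply, g.symm x v] at h
  linarith

/-- The fundamental form `ω(v, w) = g(J v, w)` of the Hermitian metric `g`. -/
noncomputable def fundamentalForm (g : HermitianMetric E X) : FormFamily E X 2 := fun x =>
  { toFun v := g.inner x (tangentJ x (v 0)) (v 1)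
    map_update_add' v i a b := by
      fin_cases i <;> simp [Function.update_of_ne]
    map_update_smul' v i c a := by
      fin_cases i <;> simp [Function.update_of_ne]
    map_eq_zero_of_eq' v i j hv hij := by
      fin_cases i <;> fin_cases j <;> simp_all [g.inner_tangentJ_self]
    cont := by
      have h (b : E →L[ℝ] E →L[ℝ] ℝ) (J : E →L[ℝ] E) :
          Continuous fun v : Fin 2 → E => b (J (v 0)) (v 1) := by fun_prop
      exact h (g.inner x) (tangentJ x) }

/-- The volume form `ωⁿ / n!` of a Hermitian metric with fundamental form `ω` on a complex manifold
of complex dimension `n`. -/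
noncomputable def volumeForm (g : HermitianMetric E X) :
    FormFamily E X (2 * Module.finrank ℂ E) := fun x =>
  ((Module.finrank ℂ E).factorial : ℝ)⁻¹ • wedgePower (g.fundamentalForm x) (Module.finrank ℂ E)

/-- A Hermitian metric with fundamental form `ω` on a complex manifold of complex dimension `n` is
balanced if `ωⁿ⁻¹` is closed. -/
def IsBalanced (g : HermitianMetric E X) : Prop :=
  FormFamily.IsClosed fun x => wedgePower (g.fundamentalForm x) (Module.finrank ℂ E - 1)

end HermitianMetric

end Manifold

/-- The quotient of a complex manifold by a free, properly discontinuous group of holomorphic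
transformations, with its quotient charts, is a complex manifold. -/
theorem AddAction.isManifold_quotient {E : Type*} [NormedAddCommGroup E] [NormedSpace ℂ E]
    {X : Type*} [TopologicalSpace X] [ChartedSpace E X] [IsManifold 𝓘(ℂ, E) ω X]
    {G : Type*} [AddGroup G] [AddAction G X] [ProperlyDiscontinuousVAdd G X]
    [ContinuousConstVAdd G X] [IsCancelVAdd G X] [T2Space X] [LocallyCompactSpace X]
    (hG : ∀ g : G, ContMDiff 𝓘(ℂ, E) 𝓘(ℂ, E) ω (fun x : X => g +ᵥ x)) :
    IsManifold 𝓘(ℂ, E) ω (AddAction.orbitRel.Quotient G X) := by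
  have hloc : IsLocalHomeomorph (Quotient.mk (AddAction.orbitRel G X)) :=
    isAddQuotientCoveringMap_quotientMk_of_properlyDiscontinuousVAdd.isCoveringMap.isLocalHomeomorph
  have hat : ∀ e ∈ atlas E (AddAction.orbitRel.Quotient G X), ∃ p : X,
      e = (hloc.localInverseAt p).trans (chartAt E p) := by
    rintro e ⟨q, rfl⟩
    exact ⟨_, rfl⟩
  refine isManifold_of_contDiffOn _ _ _ fun e e' he he' => ?_
  obtain ⟨a, rfl⟩ := hat e he
  obtain ⟨b, rfl⟩ := hat e' he'
  rintro y ⟨hy, -⟩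
  apply ContDiffAt.contDiffWithinAt
  rw [← contMDiffAt_iff_contDiffAt]
  set L := hloc.localInverseAt a with hL
  set L' := hloc.localInverseAt b with hL'
  have hs : ∀ p, L.symm p = Quotient.mk _ p := fun p => congrFun (hloc.localInverseAt_symm a) p
  have hs' : ∀ p, L'.symm p = Quotient.mk _ p := fun p => congrFun (hloc.localInverseAt_symm b) p
  obtain ⟨⟨hy1, hy2⟩, hy3, hy4⟩ := hy
  set p := (chartAt E a).symm y with hp
  replace hy3 : Quotient.mk _ p ∈ L'.source := by rw [← hs]; exact hy3
  replace hy4 : L' (Quotient.mk _ p) ∈ (chartAt E b).source := by rw [← hs]; exact hy4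
  have hq : Quotient.mk (AddAction.orbitRel G X) (L' (Quotient.mk _ p)) = Quotient.mk _ p := by
    rw [← hs', L'.left_inv hy3]
  obtain ⟨g, hg⟩ : ∃ g : G, g +ᵥ p = L' (Quotient.mk _ p) := by
    have := Quotient.exact hq
    exact this
  have key : ∀ᶠ z in 𝓝 y, L' (Quotient.mk _ ((chartAt E a).symm z)) =
      g +ᵥ (chartAt E a).symm z := by
    have hc : ContinuousAt (fun z => g +ᵥ (chartAt E a).symm z) y :=
      (continuous_const_vadd g).continuousAt.comp ((chartAt E a).continuousAt_symm hy1)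
    have hmem : L'.target ∈ 𝓝 (g +ᵥ (chartAt E a).symm y) := by
      rw [← hp, hg]
      exact L'.open_target.mem_nhds (L'.map_source hy3)
    filter_upwards [hc hmem] with z hz
    have h1 : L'.symm (g +ᵥ (chartAt E a).symm z) =
        Quotient.mk _ ((chartAt E a).symm z) := by
      rw [hs']
      exact Quotient.sound ⟨g, rfl⟩
    rw [← h1]
    exact L'.right_inv hz
  have main : ContMDiffAt 𝓘(ℂ, E) 𝓘(ℂ, E) ω
      (fun z => chartAt E b (g +ᵥ (chartAt E a).symm z)) y := by
    have h1 : ContMDiffAt 𝓘(ℂ, E) 𝓘(ℂ, E) ω (chartAt E a).symm y :=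
      (contMDiffOn_chart_symm (I := 𝓘(ℂ, E)) (x := a)).contMDiffAt
        ((chartAt E a).open_target.mem_nhds hy1)
    have h3 : ContMDiffAt 𝓘(ℂ, E) 𝓘(ℂ, E) ω (chartAt E b) (g +ᵥ p) :=
      (contMDiffOn_chart (I := 𝓘(ℂ, E)) (x := b)).contMDiffAt
        ((chartAt E b).open_source.mem_nhds (hg ▸ hy4))
    exact h3.comp y ((hG g).contMDiffAt.comp y h1)
  refine main.congr_of_eventuallyEq ?_
  filter_upwards [key] with z hz
  simp only [Function.comp_apply, modelWithCornersSelf_coe, modelWithCornersSelf_coe_symm, id,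
    OpenPartialHomeomorph.coe_trans, OpenPartialHomeomorph.trans_symm_eq_symm_trans_symm]
  rw [hs, hz]

section Suspension

variable {E : Type*} [NormedAddCommGroup E] [NormedSpace ℂ E]
  {M : Type*} [TopologicalSpace M] [ChartedSpace E M]

/-- The complex manifold `M × ℂ`, as a type of its own so that it can carry the action of `ℤ²`
defined by `f` and `τ`. -/
def SuspensionCover (_f : M ≃ₘ^ω⟮𝓘(ℂ, E), 𝓘(ℂ, E)⟯ M) (_τ : ℍ) : Type _ := M × ℂ

variable (f : M ≃ₘ^ω⟮𝓘(ℂ, E), 𝓘(ℂ, E)⟯ M) (τ : ℍ)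

namespace SuspensionCover

noncomputable instance : TopologicalSpace (SuspensionCover f τ) := inferInstanceAs (TopologicalSpace (M × ℂ))

noncomputable instance : ChartedSpace (E × ℂ) (SuspensionCover f τ) :=
  inferInstanceAs (ChartedSpace (ModelProd E ℂ) (M × ℂ))

instance [IsManifold 𝓘(ℂ, E) ω M] : IsManifold 𝓘(ℂ, E × ℂ) ω (SuspensionCover f τ) := by
  rw [modelWithCornersSelf_prod]
  exact inferInstanceAs (IsManifold (𝓘(ℂ, E).prod 𝓘(ℂ, ℂ)) ω (M × ℂ))

instance [T2Space M] : T2Space (SuspensionCover f τ) := inferInstanceAs (T2Space (M × ℂ))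

instance [FiniteDimensional ℂ E] : LocallyCompactSpace (SuspensionCover f τ) :=
  Manifold.locallyCompact_of_finiteDimensional 𝓘(ℂ, E × ℂ)

/-- The action of `ℤ²` on `M × ℂ` in which `(1, 0)` maps `(x, z)` to `(f x, z + 1)` and `(0, 1)` maps
`(x, z)` to `(x, z + τ)`. -/
instance : AddAction (ℤ × ℤ) (SuspensionCover f τ) where
  vadd a p := ((f.toEquiv ^ a.1 : Equiv.Perm M) p.1, p.2 + a.1 + a.2 * (τ : ℂ))
  zero_vadd p := by
    change (((f.toEquiv ^ (0 : ℤ) : Equiv.Perm M) p.1, p.2 + ((0 : ℤ) : ℂ) + ((0 : ℤ) : ℂ) * (τ : ℂ)) :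
      M × ℂ) = p
    simp only [zpow_zero, Equiv.Perm.one_apply, Int.cast_zero, zero_mul, add_zero]
    rfl
  add_vadd a b p := by
    change (((f.toEquiv ^ (a.1 + b.1) : Equiv.Perm M) p.1,
        p.2 + ((a.1 + b.1 : ℤ) : ℂ) + ((a.2 + b.2 : ℤ) : ℂ) * (τ : ℂ)) : M × ℂ) =
      ((f.toEquiv ^ a.1 : Equiv.Perm M) ((f.toEquiv ^ b.1 : Equiv.Perm M) p.1),
        p.2 + b.1 + b.2 * (τ : ℂ) + a.1 + a.2 * (τ : ℂ))
    rw [zpow_add, Equiv.Perm.mul_apply]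
    push_cast
    congr 1
    ring

theorem vadd_def (a : ℤ × ℤ) (p : SuspensionCover f τ) :
    a +ᵥ p = (((f.toEquiv ^ a.1 : Equiv.Perm M) p.1, p.2 + a.1 + a.2 * (τ : ℂ)) : M × ℂ) :=
  rfl

theorem contMDiff_zpow (n : ℤ) :
    ContMDiff 𝓘(ℂ, E) 𝓘(ℂ, E) ω (f.toEquiv ^ n : Equiv.Perm M) := by
  induction n with
  | zero => exact contMDiff_id
  | succ n ih =>
    rw [zpow_add, zpow_one]
    exact ih.comp f.contMDiff
  | pred n ih =>
    rw [zpow_sub, zpow_one]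
    exact ih.comp f.symm.contMDiff

theorem contMDiff_vadd (a : ℤ × ℤ) :
    ContMDiff 𝓘(ℂ, E × ℂ) 𝓘(ℂ, E × ℂ) ω (fun p : SuspensionCover f τ => a +ᵥ p) := by
  have h : ContMDiff 𝓘(ℂ, ℂ) 𝓘(ℂ, ℂ) ω (fun z : ℂ => z + a.1 + a.2 * (τ : ℂ)) := by
    rw [contMDiff_iff_contDiff]
    fun_prop
  rw [modelWithCornersSelf_prod]
  exact (contMDiff_zpow f a.1).prodMap h

instance : ContinuousConstVAdd (ℤ × ℤ) (SuspensionCover f τ) :=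
  ⟨fun a => (contMDiff_vadd f τ a).continuous⟩

theorem eq_zero_of_add_mul_eq_zero (a : ℤ × ℤ) (h : (a.1 : ℂ) + a.2 * (τ : ℂ) = 0) : a = 0 := by
  have him := congrArg Complex.im h
  have hre := congrArg Complex.re h
  simp [τ.im_ne_zero] at him
  simp [him] at hre
  exact Prod.ext hre him

instance : IsCancelVAdd (ℤ × ℤ) (SuspensionCover f τ) where
  left_cancel' a p q h := by simpa using h
  right_cancel' a b p h := by
    have h2 : p.2 + a.1 + a.2 * (τ : ℂ) = p.2 + b.1 + b.2 * (τ : ℂ) := congrArg Prod.snd h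
    refine sub_eq_zero.mp (eq_zero_of_add_mul_eq_zero τ (a - b) ?_)
    simp only [Prod.fst_sub, Prod.snd_sub, Int.cast_sub]
    linear_combination h2

instance : ProperlyDiscontinuousVAdd (ℤ × ℤ) (SuspensionCover f τ) where
  finite_disjoint_inter_image {K L} hK hL := by
    have hs : Continuous (fun p : SuspensionCover f τ => p.2) :=
      (continuous_snd : Continuous (Prod.snd : M × ℂ → ℂ))
    obtain ⟨A, hA⟩ := (hK.image hs).isBounded.exists_norm_le
    obtain ⟨B, hB⟩ := (hL.image hs).isBounded.exists_norm_le
    obtain ⟨N, hN⟩ := exists_nat_ge ((A + B) / τ.im)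
    obtain ⟨N', hN'⟩ := exists_nat_ge (A + B + N * ‖(τ : ℂ)‖)
    refine ((Set.finite_Icc (-N' : ℤ) N').prod (Set.finite_Icc (-N : ℤ) N)).subset ?_
    rintro ⟨a, b⟩ ⟨_, ⟨p, hp, rfl⟩, hq⟩
    have h1 : ‖p.2‖ ≤ A := hA _ ⟨p, hp, rfl⟩
    have h2 : ‖p.2 + a + b * (τ : ℂ)‖ ≤ B := hB _ ⟨_, hq, rfl⟩
    have h3 : ‖(a : ℂ) + b * (τ : ℂ)‖ ≤ A + B := by
      have := norm_sub_le (p.2 + a + b * (τ : ℂ)) p.2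
      rw [show p.2 + a + b * (τ : ℂ) - p.2 = a + b * (τ : ℂ) by ring] at this
      linarith
    have h4 : |(b : ℝ)| * τ.im ≤ A + B := by
      have := (Complex.abs_im_le_norm _).trans h3
      simpa [abs_mul, abs_of_pos τ.im_pos] using this
    have h5 : |(b : ℝ)| ≤ N := ((le_div_iff₀ τ.im_pos).mpr h4).trans hN
    have h6 : |(a : ℝ)| ≤ N' := by
      have h7 := norm_sub_le ((a : ℂ) + b * (τ : ℂ)) (b * (τ : ℂ))
      rw [add_sub_cancel_right, norm_mul, Complex.norm_intCast, Complex.norm_intCast] at h7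
      have := mul_le_mul_of_nonneg_right h5 (norm_nonneg (τ : ℂ))
      linarith
    rw [abs_le] at h5 h6
    simp only [Set.mem_prod, Set.mem_Icc]
    exact_mod_cast And.intro h6 h5

end SuspensionCover

/-- The suspension `M_f`: the quotient of `M × ℂ` by the action of `ℤ²`. -/
def Suspension : Type _ := AddAction.orbitRel.Quotient (ℤ × ℤ) (SuspensionCover f τ)

namespace Suspension

noncomputable instance : TopologicalSpace (Suspension f τ) :=
  inferInstanceAs (TopologicalSpace (AddAction.orbitRel.Quotient (ℤ × ℤ) (SuspensionCover f τ)))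

variable [FiniteDimensional ℂ E] [T2Space M]

instance : T2Space (Suspension f τ) :=
  inferInstanceAs (T2Space (Quotient (AddAction.orbitRel (ℤ × ℤ) (SuspensionCover f τ))))

/-- The charts of the suspension are the local inverses of the quotient map `M × ℂ → M_f`, followed
by the charts of `M × ℂ`. -/
noncomputable instance : ChartedSpace (E × ℂ) (Suspension f τ) :=
  inferInstanceAs
    (ChartedSpace (E × ℂ) (AddAction.orbitRel.Quotient (ℤ × ℤ) (SuspensionCover f τ)))

instance [IsManifold 𝓘(ℂ, E) ω M] : IsManifold 𝓘(ℂ, E × ℂ) ω (Suspension f τ) :=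
  AddAction.isManifold_quotient (SuspensionCover.contMDiff_vadd f τ)

end Suspension

end Suspension

/-! Let m be the dimension of M, and suppose m > 0. The metrics g_k = (f^{-k})^* g
(`HermitianMetric.transport`) are all balanced and all have the volume form of g. The function s(z)
= Re z - (Re τ / Im τ) Im z (`Suspension.time`) is invariant under z ↦ z + τ and grows by 1 under z
↦ z + 1. So a metric on M × ℂ built at time s from the sequence g_k with weights w_k(s), where
w_{k+1}(s + 1) = w_k(s), descends to M_f (`pullbackBilin_sectionForm`).

The point is to interpolate so that the result is balanced: the objects to be averaged are the
closed forms ω_k^{m-1}, not the ω_k. Contracting ω^m with the Poisson bivector of ω gives a constant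
multiple of ω^{m-1} (`bivectorContraction_wedgePower`). Hence, among metrics with one fixed volume
form, ω^{m-1} is linear in the metric induced on the dual space. So the dual metrics are averaged:
h_s is the metric whose dual is Σ w_k(s) g_k^{-1} (`meanForm`), and c > 0 is the function for which
c h_s has the volume of g (`volumeFactor`). Then c (ω_{c h_s})^{m-1} = Σ w_k(s) ω_k^{m-1}
(`wedgePower_volumeFactor_smul`).

The metric on M × ℂ is c (h_s + |dz|²). As dx ∧ dy = ds ∧ dy, the m-th power of its fundamental form
is ω^m + m ds ∧ dy ∧ Σ w_k(s) ω_k^{m-1} (`wedgePower_sectionForm`). The first term is a top-degree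
form pulled back from M, hence closed. In the second, the ω_k^{m-1} are closed and the differential
of w_k(s) is a multiple of ds, which ds kills (`extDeriv_wedgeOne_wedgeOne_smul`). For m = 0 the
suspension is a curve and the condition concerns the constant 1. -/

/-! ### Exterior algebra of powers of a 2-form: interior products and contraction with a bivector.
-/

section ExteriorAlgebra

open ContinuousAlternatingMap

/-- Expansion of an alternatization along the argument in the first slot. -/
theorem ContinuousMultilinearMap.alternatization_apply_succ {V : Type*} [AddCommGroup V]
    [Module ℝ V] [TopologicalSpace V] {n : ℕ}
    (A : ContinuousMultilinearMap ℝ (fun _ : Fin (n + 1) => V) ℝ)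
    (B : V → ContinuousMultilinearMap ℝ (fun _ : Fin n => V) ℝ)
    (h : ∀ v, A v = B (v 0) (Fin.tail v)) (v : Fin (n + 1) → V) :
    alternatization A v =
      ∑ p : Fin (n + 1), (-1) ^ (p : ℕ) • alternatization (B (v p)) (p.removeNth v) := by
  -- A permutation of n + 1 letters is its first value p together with a permutation τ of the
  -- remaining letters; its sign is (-1)^p sign τ.
  let ψ : Fin (n + 1) × Equiv.Perm (Fin n) → Equiv.Perm (Fin (n + 1)) := fun q =>
    q.1.cycleRange.symm * Equiv.Perm.decomposeFin.symm (0, q.2)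
  have h0 (q) : ψ q 0 = q.1 := by simp [ψ]
  have hs (q) (j : Fin n) : ψ q j.succ = q.1.succAbove (q.2 j) := by simp [ψ]
  have hb : Function.Bijective ψ := by
    rw [Fintype.bijective_iff_injective_and_card]
    refine ⟨fun q q' e => ?_, ?_⟩
    · have e1 : q.1 = q'.1 := by rw [← h0, e, h0]
      refine Prod.ext e1 (Equiv.ext fun j => ?_)
      have := hs q j
      rw [e, hs, e1] at this
      exact (Fin.succAbove_right_injective this).symm
    · simp [Fintype.card_perm, Nat.factorial_succ]
  rw [alternatization_apply_apply, ← hb.sum_comp, Fintype.sum_prod_type]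
  refine Finset.sum_congr rfl fun p _ => ?_
  rw [alternatization_apply_apply, Finset.smul_sum]
  refine Finset.sum_congr rfl fun τ _ => ?_
  have e1 : A (v ∘ ψ (p, τ)) = B (v p) (p.removeNth v ∘ τ) := by
    rw [h]
    congr 1
    · simp [h0]
    · ext j
      simp [Fin.tail, hs, Fin.removeNth]
  rw [e1]
  simp only [ψ, map_mul, Equiv.Perm.sign_symm, Fin.sign_cycleRange,
    Equiv.Perm.decomposeFin.symm_sign, if_true, one_mul, mul_smul]
  rw [Units.smul_def]
  simp

variable {V : Type*} [NormedAddCommGroup V] [NormedSpace ℝ V] {n : ℕ}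

/-- The exterior product of a 1-form and an `n`-form. -/
noncomputable def wedgeOne (η : V →L[ℝ] ℝ) (β : V [⋀^Fin n]→L[ℝ] ℝ) : V [⋀^Fin (n + 1)]→L[ℝ] ℝ :=
  alternatizeUncurryFin (η.smulRight β)

/-- The 1-form `α(v, ·)`. -/
noncomputable def contractTwo (α : V [⋀^Fin 2]→L[ℝ] ℝ) : V →L[ℝ] V →L[ℝ] ℝ :=
  ((ofSubsingletonLIE (𝕜 := ℝ) (E := V) (F := ℝ) (0 : Fin 1)).symm.toContinuousLinearEquiv :
    V [⋀^Fin 1]→L[ℝ] ℝ →L[ℝ] V →L[ℝ] ℝ) ∘L α.curryLeft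

theorem contractTwo_apply (α : V [⋀^Fin 2]→L[ℝ] ℝ) (v w : V) :
    contractTwo α v w = α ![v, w] := by
  change α (Matrix.vecCons v fun _ => w) = _
  congr 1
  ext i
  fin_cases i <;> rfl

/-- The exterior product as a continuous bilinear map. -/
noncomputable def wedgeOneCLM :
    (V →L[ℝ] ℝ) →L[ℝ] V [⋀^Fin n]→L[ℝ] ℝ →L[ℝ] V [⋀^Fin (n + 1)]→L[ℝ] ℝ :=
  ((alternatizeUncurryFinCLM ℝ V ℝ).postcomp (V [⋀^Fin n]→L[ℝ] ℝ)) ∘L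
    ContinuousLinearMap.smulRightL ℝ V (V [⋀^Fin n]→L[ℝ] ℝ)

theorem wedgeOneCLM_apply (η : V →L[ℝ] ℝ) (β : V [⋀^Fin n]→L[ℝ] ℝ) :
    wedgeOneCLM η β = wedgeOne η β := rfl

theorem wedgePower_zero (α : V [⋀^Fin 2]→L[ℝ] ℝ) (v : Fin (2 * 0) → V) : wedgePower α 0 v = 1 := by
  simp only [wedgePower, pow_zero, inv_one, one_smul,
    ContinuousMultilinearMap.alternatization_apply_apply]
  have h (w : Fin (2 * 0) → V) : tensorPower α 0 w = 1 :=
    Fin.prod_univ_zero (fun i : Fin 0 => α (w ∘ pairIndex i))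
  simp [h]

theorem tensorPower_succ (α : V [⋀^Fin 2]→L[ℝ] ℝ) (k : ℕ) (v : Fin (2 * k + 1 + 1) → V) :
    tensorPower α (k + 1) v = α ![v 0, v 1] * tensorPower α k (Fin.tail (Fin.tail v)) := by
  change ∏ i : Fin (k + 1), α (_ ∘ pairIndex i) = _ * ∏ i : Fin k, α (_ ∘ pairIndex i)
  rw [Fin.prod_univ_succ]
  congr 1
  · congr 1
    ext i
    fin_cases i <;> rfl
  · refine Finset.prod_congr rfl fun i _ => ?_
    congr 1
    ext j
    simp only [Function.comp, Fin.tail]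
    congr 1
    simp [pairIndex, Fin.ext_iff]
    omega

/-- Expanding the alternatization along its first two slots isolates one factor α. This recursion
replaces the sum over permutations in everything that follows. -/
theorem wedgePower_succ (α : V [⋀^Fin 2]→L[ℝ] ℝ) (k : ℕ) :
    wedgePower α (k + 1) = (2 : ℝ)⁻¹ • alternatizeUncurryFin
      ((wedgeOneCLM (n := 2 * k)).flip (wedgePower α k) ∘L contractTwo α) := by
  ext v
  change Fin (2 * k + 1 + 1) → V at v
  have h1 := ContinuousMultilinearMap.alternatization_apply_succ
    (tensorPower α (k + 1)) (fun x => (tensorPower α (k + 1)).curryLeft x)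
    (fun v => by rw [ContinuousMultilinearMap.curryLeft_apply, Fin.cons_self_tail]) v
  have h2 (x : V) := ContinuousMultilinearMap.alternatization_apply_succ (n := 2 * k)
    ((tensorPower α (k + 1)).curryLeft x) (fun y => α ![x, y] • tensorPower α k)
    (fun v => by
      rw [ContinuousMultilinearMap.curryLeft_apply]
      exact tensorPower_succ α k (Fin.cons x v))
  have h3 (c : ℝ) (w : Fin (2 * k) → V) : ContinuousMultilinearMap.alternatization
      (c • tensorPower α k) w = c * ContinuousMultilinearMap.alternatization (tensorPower α k) w :=
          by
    simp only [ContinuousMultilinearMap.alternatization_apply_apply, Finset.mul_sum]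
    refine Finset.sum_congr rfl fun σ _ => ?_
    change _ • (c * _) = c * (_ • _)
    rw [mul_smul_comm]
    rfl
  change ((2 : ℝ) ^ (k + 1))⁻¹ • ContinuousMultilinearMap.alternatization
    (tensorPower α (k + 1)) v = _
  rw [h1, ContinuousAlternatingMap.smul_apply]
  simp only [h2, h3, alternatizeUncurryFin_apply, ContinuousLinearMap.comp_apply,
    ContinuousLinearMap.flip_apply, wedgeOneCLM_apply, wedgeOne, contractTwo_apply,
    ContinuousLinearMap.smulRight_apply, ContinuousAlternatingMap.smul_apply, wedgePower,
    smul_eq_mul, Finset.smul_sum, Finset.mul_sum]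
  refine Finset.sum_congr rfl fun i _ => Finset.sum_congr rfl fun j _ => ?_
  simp only [zsmul_eq_mul, pow_succ, mul_inv]
  ring

/-- The interior product with the vector `v`. -/
noncomputable def interiorCLM (v : V) : V [⋀^Fin (n + 1)]→L[ℝ] ℝ →L[ℝ] V [⋀^Fin n]→L[ℝ] ℝ :=
  (ContinuousLinearMap.apply ℝ (V [⋀^Fin n]→L[ℝ] ℝ) v) ∘L
    (curryLeftLI (𝕜 := ℝ) (E := V) (F := ℝ) (n := n)).toContinuousLinearMap

theorem interiorCLM_apply (v : V) (β : V [⋀^Fin (n + 1)]→L[ℝ] ℝ) :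
    interiorCLM v β = β.curryLeft v := rfl

theorem curryLeft_alternatizeUncurryFin (φ : V →L[ℝ] V [⋀^Fin (n + 1)]→L[ℝ] ℝ) (v : V) :
    (alternatizeUncurryFin φ).curryLeft v =
      φ v - alternatizeUncurryFin (interiorCLM v ∘L φ) := by
  ext w
  rw [curryLeft_apply_apply, alternatizeUncurryFin_apply, Fin.sum_univ_succ,
    ContinuousAlternatingMap.sub_apply, alternatizeUncurryFin_apply, sub_eq_add_neg,
    ← Finset.sum_neg_distrib]
  congr 1
  · rw [Fin.val_zero, pow_zero, one_smul, Matrix.cons_val_zero]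
    rfl
  · refine Finset.sum_congr rfl fun i _ => ?_
    rw [ContinuousLinearMap.comp_apply, interiorCLM_apply, curryLeft_apply_apply]
    have h : i.succ.removeNth (Matrix.vecCons v w) = Matrix.vecCons v (i.removeNth w) := by
      ext j
      refine Fin.cases ?_ (fun j => ?_) j <;> simp [Fin.removeNth]
    rw [h]
    simp [pow_succ]

theorem curryLeft_alternatizeUncurryFin_zero (φ : V →L[ℝ] V [⋀^Fin 0]→L[ℝ] ℝ) (v : V) :
    (alternatizeUncurryFin φ).curryLeft v = φ v := by
  ext w
  rw [curryLeft_apply_apply, alternatizeUncurryFin_apply, Fin.sum_univ_succ, Fin.sum_univ_zero,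
    add_zero, Fin.val_zero, pow_zero, one_smul, Matrix.cons_val_zero]
  congr 1

/-- The map (x, y) ↦ η(y) φ(x) + η(x) φ(y) is symmetric, so alternating it twice gives zero, as in
d² = 0; its two summands give the two sides. The anticommutation of 1-forms and the rule d(η ∧ β) =
-η ∧ dβ for constant η are both instances. -/
theorem alternatizeUncurryFin_wedgeOne (η : V →L[ℝ] ℝ) (φ : V →L[ℝ] V [⋀^Fin n]→L[ℝ] ℝ) :
    alternatizeUncurryFin (wedgeOneCLM η ∘L φ) = -wedgeOne η (alternatizeUncurryFin φ) := by
  have h := alternatizeUncurryFin_alternatizeUncurryFinCLM_comp_of_symmetric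
    (f := (ContinuousLinearMap.smulRightL ℝ V (V [⋀^Fin n]→L[ℝ] ℝ) η) ∘L φ + η.smulRight φ)
    (fun x y => by simp [add_comm])
  have e : alternatizeUncurryFinCLM ℝ V ℝ ∘L
      ((ContinuousLinearMap.smulRightL ℝ V (V [⋀^Fin n]→L[ℝ] ℝ) η) ∘L φ + η.smulRight φ) =
      wedgeOneCLM η ∘L φ + η.smulRight (alternatizeUncurryFin φ) := by
    ext x : 1
    simp only [ContinuousLinearMap.comp_apply, _root_.add_apply, map_add,
      ContinuousLinearMap.smulRight_apply, map_smul]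
    rfl
  rw [e, alternatizeUncurryFin_add] at h
  exact eq_neg_of_add_eq_zero_left h

theorem wedgeOne_wedgeOne (η θ : V →L[ℝ] ℝ) (β : V [⋀^Fin n]→L[ℝ] ℝ) :
    wedgeOne η (wedgeOne θ β) = -wedgeOne θ (wedgeOne η β) := by
  have h := alternatizeUncurryFin_wedgeOne η (θ.smulRight β)
  have e : wedgeOneCLM η ∘L θ.smulRight β = θ.smulRight (wedgeOne η β) := by
    ext x : 1
    simp only [ContinuousLinearMap.comp_apply, ContinuousLinearMap.smulRight_apply, map_smul]
    rfl
  rw [e] at h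
  change wedgeOne θ _ = -wedgeOne η (wedgeOne θ β) at h
  rw [h, neg_neg]

theorem wedgeOne_wedgeOne_self (η : V →L[ℝ] ℝ) (β : V [⋀^Fin n]→L[ℝ] ℝ) :
    wedgeOne η (wedgeOne η β) = 0 := by
  have h := wedgeOne_wedgeOne η η β
  rw [eq_neg_iff_add_eq_zero, ← two_smul ℝ] at h
  exact (smul_eq_zero_iff_right two_ne_zero).mp h

theorem wedgeOne_add (η : V →L[ℝ] ℝ) (β γ : V [⋀^Fin n]→L[ℝ] ℝ) :
    wedgeOne η (β + γ) = wedgeOne η β + wedgeOne η γ := map_add (wedgeOneCLM η) β γ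

theorem wedgeOne_sub (η : V →L[ℝ] ℝ) (β γ : V [⋀^Fin n]→L[ℝ] ℝ) :
    wedgeOne η (β - γ) = wedgeOne η β - wedgeOne η γ := map_sub (wedgeOneCLM η) β γ

theorem wedgeOne_smul (η : V →L[ℝ] ℝ) (c : ℝ) (β : V [⋀^Fin n]→L[ℝ] ℝ) :
    wedgeOne η (c • β) = c • wedgeOne η β := map_smul (wedgeOneCLM η) c β

theorem add_wedgeOne (η θ : V →L[ℝ] ℝ) (β : V [⋀^Fin n]→L[ℝ] ℝ) :
    wedgeOne (η + θ) β = wedgeOne η β + wedgeOne θ β := map_add ((wedgeOneCLM (V := V) (n :=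
        n)).flip β) η θ

theorem sub_wedgeOne (η θ : V →L[ℝ] ℝ) (β : V [⋀^Fin n]→L[ℝ] ℝ) :
    wedgeOne (η - θ) β = wedgeOne η β - wedgeOne θ β := map_sub ((wedgeOneCLM (V := V) (n :=
        n)).flip β) η θ

theorem smul_wedgeOne (c : ℝ) (η : V →L[ℝ] ℝ) (β : V [⋀^Fin n]→L[ℝ] ℝ) :
    wedgeOne (c • η) β = c • wedgeOne η β := map_smul ((wedgeOneCLM (V := V) (n := n)).flip β) c η

theorem curryLeft_wedgeOne (η : V →L[ℝ] ℝ) (β : V [⋀^Fin (n + 1)]→L[ℝ] ℝ) (v : V) :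
    (wedgeOne η β).curryLeft v = η v • β - wedgeOne η (β.curryLeft v) := by
  rw [wedgeOne, curryLeft_alternatizeUncurryFin]
  congr 2

theorem curryLeft_wedgeOne_zero (η : V →L[ℝ] ℝ) (β : V [⋀^Fin 0]→L[ℝ] ℝ) (v : V) :
    (wedgeOne η β).curryLeft v = η v • β := by
  rw [wedgeOne, curryLeft_alternatizeUncurryFin_zero]
  rfl

theorem contractTwo_symm (α : V [⋀^Fin 2]→L[ℝ] ℝ) (v w : V) :
    contractTwo α v w = -contractTwo α w v := by
  rw [contractTwo_apply, contractTwo_apply]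
  have := α.toAlternatingMap.map_swap ![w, v] (i := 0) (j := 1) (by decide)
  refine Eq.trans ?_ this
  change α _ = α _
  congr 1
  ext i
  fin_cases i <;> rfl

/-- The interior product is an antiderivation and α has even degree, so each of the k + 1 factors
contributes the same term. The induction runs through `wedgePower_succ`; k = 0 is separate because a
scalar has no interior product. -/
theorem curryLeft_wedgePower_succ (α : V [⋀^Fin 2]→L[ℝ] ℝ) (k : ℕ) (v : V) :
    curryLeft (n := 2 * k + 1) (wedgePower α (k + 1)) v =
      ((k : ℝ) + 1) • wedgeOne (contractTwo α v) (wedgePower α k) := by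
  have key (w : V [⋀^Fin (2 * k)]→L[ℝ] ℝ) (x : V) :
      ((wedgeOneCLM (n := 2 * _)).flip w ∘L contractTwo α) x = wedgeOne (contractTwo α x) w := rfl
  rw [wedgePower_succ]
  change interiorCLM v (_ • _) = _
  rw [map_smul, interiorCLM_apply, curryLeft_alternatizeUncurryFin]
  cases k with
  | zero =>
    have : interiorCLM v ∘L (wedgeOneCLM (n := 2 * 0)).flip (wedgePower α 0) ∘L contractTwo α =
        (-1 : ℝ) • (contractTwo α v).smulRight (wedgePower α 0) := by
      ext x : 1
      change curryLeft (wedgeOne (contractTwo α x) (wedgePower α 0)) v =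
        (-1 : ℝ) • contractTwo α v x • wedgePower α 0
      rw [curryLeft_wedgeOne_zero, contractTwo_symm]
      module
    rw [this, alternatizeUncurryFin_smul, key]
    change _ • (wedgeOne _ _ - (-1 : ℝ) • wedgeOne _ _) = _
    push_cast
    module
  | succ k =>
    have ih := curryLeft_wedgePower_succ α k v
    have : interiorCLM v ∘L (wedgeOneCLM (n := 2 * (k + 1))).flip (wedgePower α (k + 1)) ∘L
        contractTwo α = (-1 : ℝ) • (contractTwo α v).smulRight (wedgePower α (k + 1)) +
          ((k : ℝ) + 1) • (wedgeOneCLM (contractTwo α v) ∘L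
            (wedgeOneCLM (n := 2 * k)).flip (wedgePower α k) ∘L contractTwo α) := by
      ext x : 1
      change curryLeft (n := 2 * k + 2) (wedgeOne (n := 2 * k + 2) (contractTwo α x)
        (wedgePower α (k + 1))) v =
          (-1 : ℝ) • contractTwo α v x • wedgePower α (k + 1) + ((k : ℝ) + 1) • wedgeOne
              (contractTwo α v)
          (wedgeOne (contractTwo α x) (wedgePower α k))
      rw [curryLeft_wedgeOne, ih, wedgeOne_smul, contractTwo_symm,
        wedgeOne_wedgeOne (contractTwo α v)]
      module
    rw [this, alternatizeUncurryFin_add, alternatizeUncurryFin_smul,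
      alternatizeUncurryFin_smul, alternatizeUncurryFin_wedgeOne]
    have e := wedgePower_succ α k
    rw [eq_comm, inv_smul_eq_iff₀ two_ne_zero] at e
    rw [e]
    change _ • (wedgeOne _ _ - ((-1 : ℝ) • wedgeOne _ _ + _)) = _
    rw [wedgeOne_smul]
    push_cast
    module

/-- Two forms of positive degree agree if their interior products with every vector agree. -/
theorem ext_curryLeft {β γ : V [⋀^Fin (n + 1)]→L[ℝ] ℝ} (h : ∀ v, β.curryLeft v = γ.curryLeft v) :
    β = γ := by
  ext v
  have := DFunLike.congr_fun (h (v 0)) (Fin.tail v)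
  rw [curryLeft_apply_apply, curryLeft_apply_apply] at this
  simpa [Matrix.vecCons] using this

/-- The hypothesis says α' = α + σ ∧ θ. As (σ ∧ θ)² = 0, the binomial expansion stops after the
linear term. Both sides are compared through their interior products, so no general wedge product is
needed. -/
theorem wedgePower_add_wedge {α α' : V [⋀^Fin 2]→L[ℝ] ℝ} {σ θ : V →L[ℝ] ℝ}
    (h : ∀ v, contractTwo α' v = contractTwo α v + (σ v • θ - θ v • σ)) (k : ℕ) :
    wedgePower α' (k + 1) = wedgePower α (k + 1) +
      ((k : ℝ) + 1) • wedgeOne (n := 2 * k + 1) σ (wedgeOne θ (wedgePower α k)) := by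
  refine ext_curryLeft (n := 2 * k + 1) fun v => ?_
  have hr : ((wedgePower α (k + 1) + ((k : ℝ) + 1) • wedgeOne (n := 2 * k + 1) σ
      (wedgeOne θ (wedgePower α k)) : V [⋀^Fin (2 * k + 1 + 1)]→L[ℝ] ℝ)).curryLeft v =
      ((k : ℝ) + 1) • wedgeOne (contractTwo α v) (wedgePower α k) +
        ((k : ℝ) + 1) • (wedgeOne (n := 2 * k + 1) σ (wedgeOne θ (wedgePower α k))).curryLeft v :=
            by
    rw [← curryLeft_wedgePower_succ]
    rfl
  rw [hr, curryLeft_wedgePower_succ, h, curryLeft_wedgeOne, add_wedgeOne, sub_wedgeOne,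
    smul_wedgeOne, smul_wedgeOne]
  cases k with
  | zero =>
    have h0 : wedgePower α' 0 = wedgePower α 0 := by
      ext w
      rw [wedgePower_zero, wedgePower_zero]
    rw [curryLeft_wedgeOne_zero (V := V), h0, wedgeOne_smul]
    module
  | succ k =>
    rw [wedgePower_add_wedge h k, curryLeft_wedgeOne (n := 2 * k + 1),
      curryLeft_wedgePower_succ]
    simp only [wedgeOne_add, wedgeOne_sub, wedgeOne_smul, wedgeOne_wedgeOne_self]
    rw [wedgeOne_wedgeOne θ σ, wedgeOne_wedgeOne_self, wedgeOne_wedgeOne θ (contractTwo α v),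
      wedgeOne_wedgeOne (contractTwo α v) σ]
    have e := map_neg (wedgeOneCLM (n := 2 * k + 1 + 1) σ)
      (wedgeOne (contractTwo α v) (wedgeOne θ (wedgePower α k)))
    simp only [wedgeOneCLM_apply] at e
    have e0 := map_zero (wedgeOneCLM (V := V) (n := 2 * k + 1 + 1) σ)
    simp only [wedgeOneCLM_apply] at e0
    rw [e, e0]
    module

/-- The `i`-th coordinate with respect to the basis `b`. -/
noncomputable def coordCLM {ι : Type*} [FiniteDimensional ℝ V] (b : Module.Basis ι ℝ V) (i : ι) :
    V →L[ℝ] ℝ := (b.coord i).toContinuousLinearMap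

section Basis

variable {ι : Type*} [Fintype ι] [FiniteDimensional ℝ V] (b : Module.Basis ι ℝ V)

/-- The operator Σ bⁱ ∧ ι_{bᵢ} is the degree operator: alternating a form that is already
alternating multiplies it by its degree. -/
theorem sum_wedgeOne_curryLeft (γ : V [⋀^Fin (n + 1)]→L[ℝ] ℝ) :
    ∑ i, wedgeOne (coordCLM b i) (γ.curryLeft (b i)) = ((n : ℝ) + 1) • γ := by
  have h : γ.curryLeft = ∑ i, (coordCLM b i).smulRight (γ.curryLeft (b i)) := by
    ext x : 1
    conv_lhs => rw [← b.sum_repr x]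
    rw [_root_.map_sum, _root_.sum_apply]
    refine Finset.sum_congr rfl fun i _ => ?_
    rw [map_smul, ContinuousLinearMap.smulRight_apply]
    rfl
  have h2 := alternatizeUncurryFin_curryLeft γ
  rw [h, ← alternatizeUncurryFinCLM_apply, _root_.map_sum] at h2
  refine Eq.trans h2 ?_
  rw [← Nat.cast_smul_eq_nsmul ℝ]
  push_cast
  rfl

/-- The contraction of an `(n + 2)`-form with the bivector given by `N : V* → V`. -/
noncomputable def bivectorContraction (β : V [⋀^Fin (n + 1 + 1)]→L[ℝ] ℝ) :
    ((V →L[ℝ] ℝ) →L[ℝ] V) →ₗ[ℝ] V [⋀^Fin n]→L[ℝ] ℝ where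
  toFun N := ∑ i, (β.curryLeft (N (coordCLM b i))).curryLeft (b i)
  map_add' N N' := by
    simp [Finset.sum_add_distrib]
  map_smul' c N := by
    simp [Finset.smul_sum]

/-- Since N inverts α, contracting α^{k+1} with N bⁱ leaves (k + 1) bⁱ ∧ α^k. Then Σ ι_{bᵢ}(bⁱ ∧
α^k) is the dimension minus the degree operator on α^k, that is, dim V - 2k. -/
theorem bivectorContraction_wedgePower {α : V [⋀^Fin 2]→L[ℝ] ℝ} {N : (V →L[ℝ] ℝ) →L[ℝ] V}
    (hN : ∀ ξ, contractTwo α (N ξ) = ξ) (k : ℕ) :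
    bivectorContraction b (n := 2 * k) (wedgePower α (k + 1)) N =
      (((k : ℝ) + 1) * (Fintype.card ι - 2 * k)) • wedgePower α k := by
  have hc (i : ι) : coordCLM b i (b i) = 1 := by simp [coordCLM]
  have h1 (i : ι) : (curryLeft (n := 2 * k + 1) (wedgePower α (k + 1))
      (N (coordCLM b i))).curryLeft (b i) =
        ((k : ℝ) + 1) • (wedgeOne (coordCLM b i) (wedgePower α k)).curryLeft (b i) := by
    rw [curryLeft_wedgePower_succ, hN]
    rfl
  change ∑ i, (curryLeft (n := 2 * k + 1) (wedgePower α (k + 1))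
      (N (coordCLM b i))).curryLeft (b i) = _
  simp only [h1]
  rw [← Finset.smul_sum, mul_smul]
  congr 1
  cases k with
  | zero =>
    have h2 (i : ι) : (wedgeOne (n := 2 * 0) (coordCLM b i) (wedgePower α 0)).curryLeft (b i) =
        (1 : ℝ) • wedgePower α 0 := by
      rw [← hc i]
      exact curryLeft_wedgeOne_zero (V := V) _ _ _
    simp only [h2]
    rw [Finset.sum_const, Finset.card_univ, ← Nat.cast_smul_eq_nsmul ℝ]
    push_cast
    module
  | succ k =>
    have h2 (i : ι) : (wedgeOne (n := 2 * (k + 1)) (coordCLM b i)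
        (wedgePower α (k + 1))).curryLeft (b i) = (1 : ℝ) • wedgePower α (k + 1) -
          wedgeOne (n := 2 * k + 1) (coordCLM b i)
            (curryLeft (n := 2 * k + 1) (wedgePower α (k + 1)) (b i)) := by
      rw [← hc i]
      exact curryLeft_wedgeOne (n := 2 * k + 1) _ _ _
    simp only [h2]
    rw [Finset.sum_sub_distrib, sum_wedgeOne_curryLeft b (n := 2 * k + 1), Finset.sum_const,
      Finset.card_univ, ← Nat.cast_smul_eq_nsmul ℝ]
    push_cast
    module

/-- The exterior powers of a nondegenerate 2-form up to the top degree do not vanish. -/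
theorem wedgePower_ne_zero (b : Module.Basis ι ℝ V) {α : V [⋀^Fin 2]→L[ℝ] ℝ} {N : (V →L[ℝ] ℝ) →L[ℝ]
    V}
    (hN : ∀ ξ, contractTwo α (N ξ) = ξ) {k : ℕ} (hk : 2 * k ≤ Fintype.card ι) :
    wedgePower α k ≠ 0 := by
  induction k with
  | zero =>
    intro h
    have := wedgePower_zero α 0
    rw [h] at this
    exact zero_ne_one this
  | succ k ih =>
    intro h
    -- The factor (k + 1)(dim V - 2k) is nonzero in this range, so vanishing of one power descends
    -- to the previous one and finally to α⁰ = 1.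
    have h1 := bivectorContraction_wedgePower b hN k
    have h2 : bivectorContraction b (n := 2 * k) (wedgePower α (k + 1)) N = 0 := by
      rw [h]
      exact Finset.sum_eq_zero fun i _ => rfl
    rw [h2, eq_comm] at h1
    refine ih (by omega) ((smul_eq_zero_iff_right ?_).mp h1)
    have h3 : (2 * ((k : ℝ) + 1)) ≤ Fintype.card ι := by exact_mod_cast hk
    have h4 : (0 : ℝ) ≤ k := Nat.cast_nonneg k
    exact mul_ne_zero (by positivity) (by linarith)

end Basis

theorem wedgePower_compContinuousLinearMap {W : Type*} [NormedAddCommGroup W] [NormedSpace ℝ W]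
    (α : V [⋀^Fin 2]→L[ℝ] ℝ) (D : W →L[ℝ] V) (k : ℕ) :
    wedgePower (α.compContinuousLinearMap D) k =
      (wedgePower α k).compContinuousLinearMap D := by
  ext v
  simp only [wedgePower, ContinuousAlternatingMap.smul_apply,
    ContinuousAlternatingMap.compContinuousLinearMap_apply,
    ContinuousMultilinearMap.alternatization_apply_apply]
  rfl

theorem wedgePower_smul (c : ℝ) (α : V [⋀^Fin 2]→L[ℝ] ℝ) (k : ℕ) :
    wedgePower (c • α) k = c ^ k • wedgePower α k := by
  ext v
  have h (w : Fin (2 * k) → V) : tensorPower (c • α) k w = c ^ k * tensorPower α k w := by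
    change ∏ i : Fin k, c * α (w ∘ pairIndex i) = c ^ k * ∏ i : Fin k, α (w ∘ pairIndex i)
    rw [Finset.prod_mul_distrib]
    simp
  simp only [wedgePower, ContinuousAlternatingMap.smul_apply,
    ContinuousMultilinearMap.alternatization_apply_apply, h, smul_eq_mul, ← mul_smul_comm,
    ← Finset.mul_sum]
  ring

/-- `contractTwo` as a continuous linear map. -/
noncomputable def contractTwoCLM : V [⋀^Fin 2]→L[ℝ] ℝ →L[ℝ] V →L[ℝ] V →L[ℝ] ℝ :=
  (ContinuousLinearMap.postcomp V
    ((ofSubsingletonLIE (𝕜 := ℝ) (E := V) (F := ℝ) (0 : Fin 1)).symm.toContinuousLinearEquiv :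
      V [⋀^Fin 1]→L[ℝ] ℝ →L[ℝ] V →L[ℝ] ℝ)) ∘L
    (curryLeftLI (𝕜 := ℝ) (E := V) (F := ℝ) (n := 1)).toContinuousLinearMap

/-- By `wedgePower_succ` each power arises from the previous one by composition with fixed
continuous linear maps. -/
theorem contDiff_wedgePower (k : ℕ) {N : ℕ∞ω} :
    ContDiff ℝ N fun α : V [⋀^Fin 2]→L[ℝ] ℝ => wedgePower α k := by
  induction k with
  | zero =>
    have h (α : V [⋀^Fin 2]→L[ℝ] ℝ) : wedgePower α 0 = wedgePower 0 0 := by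
      ext w
      rw [wedgePower_zero, wedgePower_zero]
    simp_rw [h]
    exact contDiff_const
  | succ k ih =>
    simp_rw [wedgePower_succ]
    let L : V [⋀^Fin (2 * k)]→L[ℝ] ℝ →L[ℝ] (V →L[ℝ] ℝ) →L[ℝ] V [⋀^Fin (2 * k + 1)]→L[ℝ] ℝ :=
      wedgeOneCLM.flip
    have hL : ContDiff ℝ N fun w => L w := by fun_prop
    have h1 : ContDiff ℝ N fun α : V [⋀^Fin 2]→L[ℝ] ℝ => L (wedgePower α k) := hL.comp ih
    let L' : V [⋀^Fin 2]→L[ℝ] ℝ →L[ℝ] V →L[ℝ] V →L[ℝ] ℝ := contractTwoCLM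
    have h2 : ContDiff ℝ N fun α : V [⋀^Fin 2]→L[ℝ] ℝ => L' α := by fun_prop
    have h3 : ContDiff ℝ N fun φ : V →L[ℝ] V [⋀^Fin (2 * k + 1)]→L[ℝ] ℝ =>
        alternatizeUncurryFinCLM ℝ V ℝ φ := by fun_prop
    exact (h3.comp (h1.clm_comp h2)).const_smul ((2 : ℝ)⁻¹)

end ExteriorAlgebra

/-! ### Hermitian inner products on a complex vector space and on its dual. -/

section HermitianForms

open ContinuousAlternatingMap

variable {E : Type*} [NormedAddCommGroup E] [NormedSpace ℂ E] [NormedSpace ℝ E]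
  [IsScalarTower ℝ ℂ E]

variable (E) in
/-- Multiplication by `i` as a real linear map. -/
noncomputable def mulI : E →L[ℝ] E :=
  (Complex.I • ContinuousLinearMap.id ℂ E).restrictScalars ℝ

theorem mulI_apply (v : E) : mulI E v = Complex.I • v := rfl

theorem mulI_mulI (v : E) : mulI E (mulI E v) = -v := by
  rw [mulI_apply, mulI_apply, smul_smul, Complex.I_mul_I, neg_smul, one_smul]

/-- A Hermitian inner product on a complex vector space, given by its real part. -/
structure IsHermitianForm (b : E →L[ℝ] E →L[ℝ] ℝ) : Prop where
  symm : ∀ v w, b v w = b w v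
  pos : ∀ v, v ≠ 0 → 0 < b v v
  map_mulI : ∀ v w, b (mulI E v) w = -b v (mulI E w)

/-- A Hermitian inner product on the dual of a complex vector space, given as a map from the dual to
the space. -/
structure IsHermitianCoform (N : (E →L[ℝ] ℝ) →L[ℝ] E) : Prop where
  symm : ∀ ξ η : E →L[ℝ] ℝ, ξ (N η) = η (N ξ)
  pos : ∀ ξ : E →L[ℝ] ℝ, ξ ≠ 0 → 0 < ξ (N ξ)
  map_mulI : ∀ ξ : E →L[ℝ] ℝ, N (ξ ∘L mulI E) = -mulI E (N ξ)

theorem IsHermitianForm.map_mulI_mulI {b : E →L[ℝ] E →L[ℝ] ℝ} (hb : IsHermitianForm b) (v w : E) :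
    b (mulI E v) (mulI E w) = b v w := by
  rw [hb.map_mulI, mulI_mulI, map_neg, neg_neg]

theorem IsHermitianForm.smul {b : E →L[ℝ] E →L[ℝ] ℝ} (hb : IsHermitianForm b) {c : ℝ}
    (hc : 0 < c) : IsHermitianForm (c • b) where
  symm v w := by
    change c * b v w = c * b w v
    rw [hb.symm]
  pos v hv := mul_pos hc (hb.pos v hv)
  map_mulI v w := by
    change c * b _ w = -(c * b v _)
    rw [hb.map_mulI, mul_neg]

theorem IsHermitianForm.convex {b b' : E →L[ℝ] E →L[ℝ] ℝ} (hb : IsHermitianForm b)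
    (hb' : IsHermitianForm b') {t : ℝ} (ht : t ∈ Set.Icc (0 : ℝ) 1) :
    IsHermitianForm ((1 - t) • b + t • b') where
  symm v w := by
    change (1 - t) * b v w + t * b' v w = (1 - t) * b w v + t * b' w v
    rw [hb.symm, hb'.symm]
  pos v hv := by
    change 0 < (1 - t) * b v v + t * b' v v
    have h1 := hb.pos v hv
    have h2 := hb'.pos v hv
    rcases ht.1.eq_or_lt with h | h
    · subst h
      simpa using h1
    · have := mul_nonneg (sub_nonneg.mpr ht.2) h1.le
      have := mul_pos h h2
      linarith
  map_mulI v w := by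
    change (1 - t) * b _ w + t * b' _ w = -((1 - t) * b v _ + t * b' v _)
    rw [hb.map_mulI, hb'.map_mulI]
    ring

/-- The pullback of a bilinear form under a linear map. -/
noncomputable def pullbackBilin {F : Type*} [NormedAddCommGroup F] [NormedSpace ℝ F]
    {F' : Type*} [NormedAddCommGroup F'] [NormedSpace ℝ F']
    (D : F →L[ℝ] F') (b : F' →L[ℝ] F' →L[ℝ] ℝ) : F →L[ℝ] F →L[ℝ] ℝ :=
  (ContinuousLinearMap.compL ℝ F F' ℝ).flip D ∘L b ∘L D

theorem pullbackBilin_apply {F : Type*} [NormedAddCommGroup F] [NormedSpace ℝ F]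
    {F' : Type*} [NormedAddCommGroup F'] [NormedSpace ℝ F']
    (D : F →L[ℝ] F') (b : F' →L[ℝ] F' →L[ℝ] ℝ) (v w : F) :
    pullbackBilin D b v w = b (D v) (D w) := rfl

variable (E) in
/-- The 2-form `b(J v, w)` of a bilinear form `b`, made alternating. -/
noncomputable def fundFormCLM : (E →L[ℝ] E →L[ℝ] ℝ) →L[ℝ] E [⋀^Fin 2]→L[ℝ] ℝ :=
  let e : (E →L[ℝ] ℝ) →L[ℝ] E [⋀^Fin 1]→L[ℝ] ℝ :=
    (ofSubsingletonLIE (𝕜 := ℝ) (E := E) (F := ℝ) (0 : Fin 1)).toContinuousLinearEquiv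
  let L : (E →L[ℝ] E →L[ℝ] ℝ) →L[ℝ] E →L[ℝ] E [⋀^Fin 1]→L[ℝ] ℝ :=
    ContinuousLinearMap.postcomp E e ∘L (ContinuousLinearMap.compL ℝ E E (E →L[ℝ] ℝ)).flip (mulI E)
  (2 : ℝ)⁻¹ • (alternatizeUncurryFinCLM ℝ E ℝ ∘L L)

theorem fundFormCLM_apply (b : E →L[ℝ] E →L[ℝ] ℝ) (v : Fin 2 → E) :
    fundFormCLM E b v = 2⁻¹ * (b (mulI E (v 0)) (v 1) - b (mulI E (v 1)) (v 0)) := by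
  change (2 : ℝ)⁻¹ • (alternatizeUncurryFin (𝕜 := ℝ) (E := E) (F := ℝ) (n := 1) _ v) = _
  rw [alternatizeUncurryFin_apply, Fin.sum_univ_two, smul_eq_mul]
  congr 1
  simp only [Fin.val_zero, pow_zero, one_smul, Fin.val_one, pow_one, neg_smul, sub_eq_add_neg]
  rfl

theorem IsHermitianForm.fundFormCLM_apply {b : E →L[ℝ] E →L[ℝ] ℝ} (hb : IsHermitianForm b)
    (v : Fin 2 → E) : fundFormCLM E b v = b (mulI E (v 0)) (v 1) := by
  rw [_root_.fundFormCLM_apply, hb.map_mulI (v 1), hb.symm (v 1)]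
  ring

theorem IsHermitianForm.contractTwo_fundFormCLM {b : E →L[ℝ] E →L[ℝ] ℝ} (hb : IsHermitianForm b)
    (v : E) : contractTwo (fundFormCLM E b) v = b (mulI E v) := by
  ext w
  rw [contractTwo_apply, hb.fundFormCLM_apply]
  rfl

theorem fundFormCLM_pullbackBilin {F : Type*} [NormedAddCommGroup F] [NormedSpace ℂ F]
    [NormedSpace ℝ F] [IsScalarTower ℝ ℂ F]
    (D : F →L[ℝ] E) (hD : ∀ v, D (mulI F v) = mulI E (D v)) (b : E →L[ℝ] E →L[ℝ] ℝ) :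
    fundFormCLM F (pullbackBilin D b) = (fundFormCLM E b).compContinuousLinearMap D := by
  ext v
  rw [compContinuousLinearMap_apply, fundFormCLM_apply, fundFormCLM_apply]
  simp only [pullbackBilin_apply, hD, Function.comp]

theorem IsHermitianForm.pullbackBilin {F : Type*} [NormedAddCommGroup F] [NormedSpace ℂ F]
    [NormedSpace ℝ F] [IsScalarTower ℝ ℂ F]
    {D : F →L[ℝ] E} (hD : ∀ v, D (mulI F v) = mulI E (D v)) (hD' : Function.Injective D)
    {b : E →L[ℝ] E →L[ℝ] ℝ} (hb : IsHermitianForm b) : IsHermitianForm (pullbackBilin D b) where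
  symm v w := hb.symm _ _
  pos v hv := hb.pos _ fun h => hv (hD' (h.trans (_root_.map_zero D).symm))
  map_mulI v w := by
    rw [pullbackBilin_apply, pullbackBilin_apply, hD, hD, hb.map_mulI]

/-- Hermitian inner products form a convex cone on the dual space too. This is what allows the
averaging to take place there. -/
theorem IsHermitianCoform.sum {ι : Type*} {S : Finset ι} {w : ι → ℝ}
    {N : ι → (E →L[ℝ] ℝ) →L[ℝ] E} (hN : ∀ i, IsHermitianCoform (N i)) (hw : ∀ i, 0 ≤ w i)
    {i₀ : ι} (hi₀ : i₀ ∈ S) (hw₀ : 0 < w i₀) : IsHermitianCoform (∑ i ∈ S, w i • N i) := by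
  have happ (ξ : E →L[ℝ] ℝ) : (∑ i ∈ S, w i • N i) ξ = ∑ i ∈ S, w i • N i ξ := by
    rw [_root_.sum_apply]
    rfl
  refine ⟨fun ξ η => ?_, fun ξ h => ?_, fun ξ => ?_⟩
  · simp only [happ, _root_.map_sum, map_smul, (hN _).symm ξ η]
  · simp only [happ, _root_.map_sum, map_smul, smul_eq_mul]
    exact Finset.sum_pos' (fun i _ => mul_nonneg (hw i) ((hN i).pos ξ h).le)
      ⟨i₀, hi₀, mul_pos hw₀ ((hN i₀).pos ξ h)⟩
  · simp only [happ, _root_.map_sum, map_smul, (hN _).map_mulI, smul_neg, Finset.sum_neg_distrib]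

section Inverse

variable [FiniteDimensional ℝ E]

theorem finrank_strongDual {F : Type*} [NormedAddCommGroup F] [NormedSpace ℝ F]
    [FiniteDimensional ℝ F] : Module.finrank ℝ (F →L[ℝ] ℝ) = Module.finrank ℝ F := by
  rw [← (LinearMap.toContinuousLinearMap (𝕜 := ℝ) (E := F) (F' := ℝ)).finrank_eq]
  exact Subspace.dual_finrank_eq

theorem ContinuousLinearMap.isInvertible_of_injective {F F' : Type*} [NormedAddCommGroup F]
    [NormedSpace ℝ F] [FiniteDimensional ℝ F] [NormedAddCommGroup F'] [NormedSpace ℝ F']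
    [FiniteDimensional ℝ F'] (h : Module.finrank ℝ F = Module.finrank ℝ F') {L : F →L[ℝ] F'}
    (hL : Function.Injective L) : L.IsInvertible := by
  refine ⟨(LinearEquiv.ofInjectiveOfFinrankEq (L : F →ₗ[ℝ] F') hL h).toContinuousLinearEquiv, ?_⟩
  ext v
  rfl

theorem IsHermitianForm.isInvertible {b : E →L[ℝ] E →L[ℝ] ℝ} (hb : IsHermitianForm b) :
    b.IsInvertible := by
  refine ContinuousLinearMap.isInvertible_of_injective finrank_strongDual.symm ?_
  refine (injective_iff_map_eq_zero b).mpr fun v hv => ?_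
  by_contra h
  have := hb.pos v h
  rw [hv] at this
  exact lt_irrefl _ this

theorem IsHermitianCoform.isInvertible {N : (E →L[ℝ] ℝ) →L[ℝ] E} (hN : IsHermitianCoform N) :
    N.IsInvertible := by
  refine ContinuousLinearMap.isInvertible_of_injective finrank_strongDual ?_
  refine (injective_iff_map_eq_zero N).mpr fun v hv => ?_
  by_contra h
  have := hN.pos v h
  rw [hv, _root_.map_zero] at this
  exact lt_irrefl _ this

theorem IsHermitianForm.inverse {b : E →L[ℝ] E →L[ℝ] ℝ} (hb : IsHermitianForm b) :
    IsHermitianCoform b.inverse := by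
  have hi := hb.isInvertible
  have hs (ξ : E →L[ℝ] ℝ) : ∃ v, b v = ξ := ⟨_, hi.self_apply_inverse ξ⟩
  refine ⟨fun ξ η => ?_, fun ξ h => ?_, fun ξ => ?_⟩
  · obtain ⟨v, rfl⟩ := hs ξ
    obtain ⟨w, rfl⟩ := hs η
    rw [hi.inverse_apply_self, hi.inverse_apply_self, hb.symm]
  · obtain ⟨v, rfl⟩ := hs ξ
    rw [hi.inverse_apply_self]
    exact hb.pos v fun h' => h (by rw [h', _root_.map_zero])
  · obtain ⟨v, rfl⟩ := hs ξ
    have : b v ∘L mulI E = b (-mulI E v) := by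
      ext w
      rw [map_neg, ContinuousLinearMap.comp_apply]
      change _ = -(b (mulI E v) w)
      rw [hb.map_mulI, neg_neg]
    rw [this, hi.inverse_apply_self, hi.inverse_apply_self]

theorem IsHermitianCoform.inverse {N : (E →L[ℝ] ℝ) →L[ℝ] E} (hN : IsHermitianCoform N) :
    IsHermitianForm N.inverse := by
  have hi := hN.isInvertible
  have hs (v : E) : ∃ ξ, N ξ = v := ⟨_, hi.self_apply_inverse v⟩
  refine ⟨fun v w => ?_, fun v h => ?_, fun v w => ?_⟩
  · obtain ⟨ξ, rfl⟩ := hs v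
    obtain ⟨η, rfl⟩ := hs w
    rw [hi.inverse_apply_self, hi.inverse_apply_self, hN.symm]
  · obtain ⟨ξ, rfl⟩ := hs v
    rw [hi.inverse_apply_self]
    exact hN.pos ξ fun h' => h (by rw [h', _root_.map_zero])
  · obtain ⟨ξ, rfl⟩ := hs v
    have : mulI E (N ξ) = N (-(ξ ∘L mulI E)) := by rw [map_neg, hN.map_mulI, neg_neg]
    rw [this, hi.inverse_apply_self, hi.inverse_apply_self]
    rfl

/-- The Poisson bivector of the fundamental form of `b`. -/
theorem IsHermitianForm.contractTwo_mulI_inverse {b : E →L[ℝ] E →L[ℝ] ℝ} (hb : IsHermitianForm b)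
    (ξ : E →L[ℝ] ℝ) : contractTwo (fundFormCLM E b) ((-(mulI E) ∘L b.inverse) ξ) = ξ := by
  rw [hb.contractTwo_fundFormCLM]
  change b (mulI E (-mulI E (b.inverse ξ))) = ξ
  rw [map_neg, mulI_mulI, neg_neg, hb.isInvertible.self_apply_inverse]

end Inverse

end HermitianForms

/-- Scalar multiples of maps into a space of bilinear forms. -/
theorem ContDiffAt.smul_bilin {X V : Type*} [NormedAddCommGroup X] [NormedSpace ℝ X]
    [NormedAddCommGroup V] [NormedSpace ℝ V] {n : ℕ∞ω} {c : X → ℝ} {f : X → V →L[ℝ] V →L[ℝ] ℝ}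
    {x : X} (hc : ContDiffAt ℝ n c x) (hf : ContDiffAt ℝ n f x) :
    ContDiffAt ℝ n (fun x => c x • f x) x := by
  have h : (fun x => c x • f x) = fun x => f x ∘L (c x • ContinuousLinearMap.id ℝ V) := by
    ext x v w
    simp
  rw [h]
  exact hf.clm_comp (hc.smul contDiffAt_const)

/-! ### Averaging dual metrics at constant volume. -/

section MeanForm

open ContinuousAlternatingMap

variable {E : Type*} [NormedAddCommGroup E] [NormedSpace ℝ E] {ι : Type*}

/-- The weighted sum of the inner products which the `b i` induce on the dual space. -/
noncomputable def meanCoform (b : ι → E →L[ℝ] E →L[ℝ] ℝ) (w : ι → ℝ) : (E →L[ℝ] ℝ) →L[ℝ] E :=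
  ∑ᶠ i, w i • (b i).inverse

theorem meanCoform_eq_sum (b : ι → E →L[ℝ] E →L[ℝ] ℝ) {w : ι → ℝ} {S : Finset ι}
    (hS : Function.support w ⊆ S) : meanCoform b w = ∑ i ∈ S, w i • (b i).inverse := by
  refine finsum_eq_sum_of_support_subset _ fun i hi => hS ?_
  rw [Function.mem_support] at hi ⊢
  intro h
  rw [h, zero_smul] at hi
  exact hi rfl

variable [NormedSpace ℂ E] [IsScalarTower ℝ ℂ E]

/-- The top exterior power of the fundamental form. -/
noncomputable def topPower (b : E →L[ℝ] E →L[ℝ] ℝ) : E [⋀^Fin (2 * Module.finrank ℂ E)]→L[ℝ] ℝ :=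
  wedgePower (fundFormCLM E b) (Module.finrank ℂ E)

theorem topPower_smul (c : ℝ) (b : E →L[ℝ] E →L[ℝ] ℝ) :
    topPower (c • b) = c ^ Module.finrank ℂ E • topPower b := by
  rw [topPower, map_smul, wedgePower_smul]
  rfl

variable [FiniteDimensional ℝ E]

variable (E) in
/-- A real basis of a complex vector space, indexed as the arguments of a top degree form. -/
noncomputable def realBasis : Module.Basis (Fin (2 * Module.finrank ℂ E)) ℝ E :=
  (Module.finBasis ℝ E).reindex (finCongr (by
    rw [← Complex.finrank_real_complex, Module.finrank_mul_finrank]))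

theorem apply_realBasis_ne_zero {Ω : E [⋀^Fin (2 * Module.finrank ℂ E)]→L[ℝ] ℝ} (hΩ : Ω ≠ 0) :
    Ω (realBasis E) ≠ 0 := by
  intro h
  refine hΩ (toAlternatingMap_injective ?_)
  rw [AlternatingMap.eq_smul_basis_det (realBasis E) Ω.toAlternatingMap]
  change Ω (realBasis E) • _ = _
  rw [h, zero_smul]
  rfl

theorem eq_smul_of_ne_zero {Ω : E [⋀^Fin (2 * Module.finrank ℂ E)]→L[ℝ] ℝ} (hΩ : Ω ≠ 0)
    (Ω' : E [⋀^Fin (2 * Module.finrank ℂ E)]→L[ℝ] ℝ) :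
    Ω' = (Ω' (realBasis E) / Ω (realBasis E)) • Ω := by
  have h := apply_realBasis_ne_zero hΩ
  refine toAlternatingMap_injective ?_
  rw [AlternatingMap.eq_smul_basis_det (realBasis E) Ω'.toAlternatingMap]
  ext v
  have h1 := congrArg (fun A => A v)
    (AlternatingMap.eq_smul_basis_det (realBasis E) Ω.toAlternatingMap)
  change Ω v = Ω (realBasis E) * (realBasis E).det v at h1
  change Ω' (realBasis E) * (realBasis E).det v = Ω' (realBasis E) / Ω (realBasis E) * Ω v
  rw [h1]
  field_simp

theorem IsHermitianForm.topPower_ne_zero {b : E →L[ℝ] E →L[ℝ] ℝ} (hb : IsHermitianForm b) :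
    topPower b ≠ 0 :=
  wedgePower_ne_zero (realBasis E) hb.contractTwo_mulI_inverse (by simp)

/-- The segment from b to b' consists of Hermitian forms, whose top powers do not vanish, so by the
intermediate value theorem the sign is constant along it. Positivity makes the real power in
`volumeFactor` positive and smooth. -/
theorem IsHermitianForm.topPower_div_pos {b b' : E →L[ℝ] E →L[ℝ] ℝ} (hb : IsHermitianForm b)
    (hb' : IsHermitianForm b') : 0 < topPower b' (realBasis E) / topPower b (realBasis E) := by
  let φ : ℝ → ℝ := fun t => topPower ((1 - t) • b + t • b') (realBasis E)
  have hφ : Continuous φ := by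
    have h1 : Continuous fun t : ℝ => (1 - t) • b + t • b' := by
      have h : ContDiff ℝ 0 fun t : ℝ => (1 - t) • b + t • b' := ?_
      · exact h.continuous
      rw [contDiff_iff_contDiffAt]
      intro t
      have h2 : ContDiffAt ℝ 0 (fun t : ℝ => (1 - t) • b) t :=
        ContDiffAt.smul_bilin (contDiffAt_const.sub contDiffAt_id) contDiffAt_const
      have h3 : ContDiffAt ℝ 0 (fun t : ℝ => t • b') t :=
        ContDiffAt.smul_bilin contDiffAt_id contDiffAt_const
      exact h2.add h3
    have h2 : Continuous fun α : E [⋀^Fin 2]→L[ℝ] ℝ => wedgePower α (Module.finrank ℂ E) :=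
      (contDiff_wedgePower _ (N := 0)).continuous
    have h3 : Continuous fun t : ℝ => topPower ((1 - t) • b + t • b') :=
      h2.comp ((fundFormCLM E).continuous.comp h1)
    exact (ContinuousEvalConst.continuous_eval_const (realBasis E : _ → E)).comp h3
  have h0 : φ 0 = topPower b (realBasis E) := by
    change topPower _ _ = _
    congr 2
    module
  have h1 : φ 1 = topPower b' (realBasis E) := by
    change topPower _ _ = _
    congr 2
    module
  have hne (t : ℝ) (ht : t ∈ Set.Icc (0 : ℝ) 1) : φ t ≠ 0 :=
    apply_realBasis_ne_zero (hb.convex hb' ht).topPower_ne_zero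
  rw [← h0, ← h1]
  by_contra hneg
  have hle : φ 1 * φ 0 ≤ 0 := by
    rw [not_lt] at hneg
    have : φ 1 * φ 0 = φ 1 / φ 0 * (φ 0 * φ 0) := by
      have := hne 0 ⟨le_rfl, zero_le_one⟩
      field_simp
    rw [this]
    exact mul_nonpos_of_nonpos_of_nonneg hneg (mul_self_nonneg _)
  have hmem : (0 : ℝ) ∈ Set.uIcc (φ 0) (φ 1) := by
    rw [Set.mem_uIcc]
    rcases mul_nonpos_iff.mp hle with h | h
    · exact Or.inl ⟨h.2, h.1⟩
    · exact Or.inr ⟨h.1, h.2⟩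
  obtain ⟨t, ht, ht'⟩ := intermediate_value_uIcc hφ.continuousOn hmem
  rw [Set.uIcc_of_le zero_le_one] at ht
  exact hne t ht ht'

/-- The inner product inducing on the dual space the weighted sum of those induced by the `b i`. -/
noncomputable def meanForm (b : ι → E →L[ℝ] E →L[ℝ] ℝ) (w : ι → ℝ) : E →L[ℝ] E →L[ℝ] ℝ :=
  (meanCoform b w).inverse

/-- The factor making the volume of `meanForm b w` equal to that of `b₀`. -/
noncomputable def volumeFactor (b₀ : E →L[ℝ] E →L[ℝ] ℝ) (b : ι → E →L[ℝ] E →L[ℝ] ℝ)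
    (w : ι → ℝ) : ℝ :=
  (topPower (meanForm b w) (realBasis E) / topPower b₀ (realBasis E)) ^
    (-(Module.finrank ℂ E : ℝ)⁻¹)

/-- Weights that are nonnegative, finitely supported and not all zero. -/
structure IsWeight (w : ι → ℝ) : Prop where
  nonneg : ∀ i, 0 ≤ w i
  exists_pos : ∃ i, 0 < w i
  finite : (Function.support w).Finite

variable {b₀ : E →L[ℝ] E →L[ℝ] ℝ} {b : ι → E →L[ℝ] E →L[ℝ] ℝ} {w : ι → ℝ}

theorem isHermitianCoform_meanCoform (hb : ∀ i, IsHermitianForm (b i)) (hw : IsWeight w) :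
    IsHermitianCoform (meanCoform b w) := by
  obtain ⟨i, hi⟩ := hw.exists_pos
  rw [meanCoform_eq_sum b hw.finite.coe_toFinset.ge]
  refine IsHermitianCoform.sum (fun i => (hb i).inverse) hw.nonneg (i₀ := i) ?_ hi
  rw [Set.Finite.mem_toFinset, Function.mem_support]
  exact hi.ne'

theorem isHermitianForm_meanForm (hb : ∀ i, IsHermitianForm (b i)) (hw : IsWeight w) :
    IsHermitianForm (meanForm b w) :=
  (isHermitianCoform_meanCoform hb hw).inverse

theorem volumeFactor_pos (hb₀ : IsHermitianForm b₀) (hb : ∀ i, IsHermitianForm (b i))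
    (hw : IsWeight w) : 0 < volumeFactor b₀ b w :=
  Real.rpow_pos_of_pos (hb₀.topPower_div_pos (isHermitianForm_meanForm hb hw)) _

theorem topPower_volumeFactor_smul (hb₀ : IsHermitianForm b₀) (hb : ∀ i, IsHermitianForm (b i))
    (hw : IsWeight w) : topPower (volumeFactor b₀ b w • meanForm b w) = topPower b₀ := by
  have hm := isHermitianForm_meanForm hb hw
  have hr := hb₀.topPower_div_pos hm
  rw [topPower_smul, eq_smul_of_ne_zero hb₀.topPower_ne_zero (topPower (meanForm b w)), smul_smul,
    volumeFactor]
  -- In dimension 0 the exponent -1/m is degenerate, but every top power is the constant 1.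
  rcases Nat.eq_zero_or_pos (Module.finrank ℂ E) with h0 | hpos
  · have h : ∀ c : E →L[ℝ] E →L[ℝ] ℝ, topPower c (realBasis E) = 1 := by
      intro c
      rw [topPower]
      generalize (realBasis E : Fin (2 * Module.finrank ℂ E) → E) = v
      revert v
      rw [h0]
      exact fun v => wedgePower_zero _ v
    rw [h, h, div_one, Real.one_rpow, one_pow, mul_one, one_smul]
  · rw [← Real.rpow_natCast, ← Real.rpow_mul hr.le, neg_mul,
      inv_mul_cancel₀ (by exact_mod_cast hpos.ne'), Real.rpow_neg_one,
      inv_mul_cancel₀ hr.ne', one_smul]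

theorem IsHermitianForm.bivectorContraction_topPower {k : ℕ} (hk : Module.finrank ℂ E = k + 1)
    {b : E →L[ℝ] E →L[ℝ] ℝ} (hb : IsHermitianForm b) :
    bivectorContraction (realBasis E) (n := 2 * k) (wedgePower (fundFormCLM E b) (k + 1))
      (-(mulI E) ∘L b.inverse) = (2 * ((k : ℝ) + 1)) • wedgePower (fundFormCLM E b) k := by
  rw [bivectorContraction_wedgePower (realBasis E) hb.contractTwo_mulI_inverse]
  congr 1
  rw [Fintype.card_fin, hk]
  push_cast
  ring

/-- Among the forms with the volume of `b₀`, the codegree one power of the fundamental form is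
linear in the induced inner product on the dual space. -/
theorem wedgePower_volumeFactor_smul {k : ℕ} (hk : Module.finrank ℂ E = k + 1)
    (hb₀ : IsHermitianForm b₀) (hb : ∀ i, IsHermitianForm (b i))
    (hvol : ∀ i, topPower (b i) = topPower b₀) (hw : IsWeight w) {S : Finset ι}
    (hS : Function.support w ⊆ S) :
    volumeFactor b₀ b w • wedgePower (fundFormCLM E (volumeFactor b₀ b w • meanForm b w)) k =
      ∑ i ∈ S, w i • wedgePower (fundFormCLM E (b i)) k := by
  have hc := volumeFactor_pos hb₀ hb hw
  have hm := (isHermitianForm_meanForm hb hw).smul hc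
  have hN := isHermitianCoform_meanCoform hb hw
  have hvol' (b : E →L[ℝ] E →L[ℝ] ℝ) (h : topPower b = topPower b₀) :
      wedgePower (fundFormCLM E b) (k + 1) = wedgePower (fundFormCLM E b₀) (k + 1) := by
    rw [topPower, topPower, hk] at h
    exact h
  have h1 := hm.bivectorContraction_topPower hk
  have h2 (i : ι) := (hb i).bivectorContraction_topPower hk
  -- Because the volumes agree, all contractions now act on the single top form of `b₀` and only the
  -- bivector varies. Linearity in the bivector gives the claim; the factor c comes from (c h)⁻¹ =
  -- c⁻¹ h⁻¹.
  rw [hvol' _ (topPower_volumeFactor_smul hb₀ hb hw)] at h1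
  simp only [hvol' _ (hvol _)] at h2
  have hinv : (volumeFactor b₀ b w • meanForm b w).inverse =
      (volumeFactor b₀ b w)⁻¹ • meanCoform b w := by
    ext ξ
    apply hm.isInvertible.injective
    rw [hm.isInvertible.self_apply_inverse]
    change ξ = volumeFactor b₀ b w • meanForm b w ((volumeFactor b₀ b w)⁻¹ • meanCoform b w ξ)
    rw [map_smul, smul_smul, mul_inv_cancel₀ hc.ne', one_smul, meanForm,
      hN.isInvertible.inverse_apply_self]
  have h3 : -(mulI E) ∘L meanCoform b w = ∑ i ∈ S, w i • (-(mulI E) ∘L (b i).inverse) := by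
    rw [meanCoform_eq_sum b hS]
    ext ξ
    simp
  have h4 : -(mulI E) ∘L ((volumeFactor b₀ b w)⁻¹ • meanCoform b w) =
      (volumeFactor b₀ b w)⁻¹ • (-(mulI E) ∘L meanCoform b w) := by
    ext ξ
    simp
  rw [hinv, h4, LinearMap.map_smul, h3, _root_.map_sum] at h1
  simp only [LinearMap.map_smul, h2] at h1
  rw [inv_smul_eq_iff₀ hc.ne'] at h1
  have h4 : (2 * ((k : ℝ) + 1)) ≠ 0 := by positivity
  refine smul_right_injective _ h4 ?_
  change (2 * ((k : ℝ) + 1)) • (_ • _) = (2 * ((k : ℝ) + 1)) • _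
  rw [smul_comm, ← h1, Finset.smul_sum]
  exact Finset.sum_congr rfl fun i _ => smul_comm _ _ _

end MeanForm

/-! ### Closedness of wedge products with constant 1-forms, and linear pullbacks. -/

section ExteriorDerivative

open ContinuousAlternatingMap

variable {V : Type*} [NormedAddCommGroup V] [NormedSpace ℝ V] {n : ℕ}

theorem HasFDerivAt.wedgeOne (η : V →L[ℝ] ℝ) {β : V → V [⋀^Fin n]→L[ℝ] ℝ}
    {β' : V →L[ℝ] V [⋀^Fin n]→L[ℝ] ℝ} {x : V} (hβ : HasFDerivAt β β' x) :
    HasFDerivAt (fun y => _root_.wedgeOne η (β y)) (wedgeOneCLM η ∘L β') x :=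
  (wedgeOneCLM η).hasFDerivAt.comp x hβ

theorem extDeriv_wedgeOne (η : V →L[ℝ] ℝ) {β : V → V [⋀^Fin n]→L[ℝ] ℝ} {x : V}
    (hβ : DifferentiableAt ℝ β x) :
    extDeriv (fun y => wedgeOne η (β y)) x = -wedgeOne η (extDeriv β x) := by
  rw [extDeriv, (hβ.hasFDerivAt.wedgeOne η).fderiv, alternatizeUncurryFin_wedgeOne, extDeriv]

theorem extDeriv_smul_of_closed {c : V → ℝ} {β : V → V [⋀^Fin n]→L[ℝ] ℝ} {x : V}
    (hc : DifferentiableAt ℝ c x) (hβ : DifferentiableAt ℝ β x) (h0 : extDeriv β x = 0) :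
    extDeriv (fun y => c y • β y) x = wedgeOne (fderiv ℝ c x) (β x) := by
  have h : HasFDerivAt (fun y => c y • β y) _ x := hc.hasFDerivAt.smul hβ.hasFDerivAt
  rw [extDeriv, h.fderiv, alternatizeUncurryFin_add,
    alternatizeUncurryFin_smul]
  rw [extDeriv] at h0
  rw [h0, smul_zero, zero_add]
  rfl

/-- The form `η ∧ θ ∧ ρ(η) β` is closed if `β` is. -/
theorem extDeriv_wedgeOne_wedgeOne_smul (η θ : V →L[ℝ] ℝ) {ρ : ℝ → ℝ}
    {β : V → V [⋀^Fin n]→L[ℝ] ℝ} {x : V} (hρ : DifferentiableAt ℝ ρ (η x))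
    (hβ : DifferentiableAt ℝ β x) (h0 : extDeriv β x = 0) :
    DifferentiableAt ℝ (fun y => wedgeOne η (wedgeOne θ (ρ (η y) • β y))) x ∧
      extDeriv (fun y => wedgeOne η (wedgeOne θ (ρ (η y) • β y))) x = 0 := by
  have hc : HasFDerivAt (fun y => ρ (η y)) (deriv ρ (η x) • η) x :=
    hρ.hasDerivAt.comp_hasFDerivAt x η.hasFDerivAt
  have h1 : DifferentiableAt ℝ (fun y => ρ (η y) • β y) x := hc.differentiableAt.smul hβ
  have h2 := (h1.hasFDerivAt.wedgeOne θ).differentiableAt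
  refine ⟨(h2.hasFDerivAt.wedgeOne η).differentiableAt, ?_⟩
  -- Passing d through η and θ costs two signs. What remains is η ∧ θ ∧ ρ'(η) η ∧ β, which vanishes
  -- because η occurs twice.
  rw [extDeriv_wedgeOne η h2, extDeriv_wedgeOne θ h1,
    extDeriv_smul_of_closed hc.differentiableAt hβ h0, hc.fderiv, smul_wedgeOne,
    wedgeOne_smul, wedgeOne_wedgeOne θ η]
  have e (γ : V [⋀^Fin (n + 1 + 1)]→L[ℝ] ℝ) : wedgeOne η (-γ) = -wedgeOne η γ :=
    map_neg (wedgeOneCLM η) γ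
  rw [e, wedgeOne_smul, e, wedgeOne_wedgeOne_self]
  module

theorem continuousAlternatingMap_eq_zero_of_finrank_lt [FiniteDimensional ℝ V]
    (h : Module.finrank ℝ V < n) (β : V [⋀^Fin n]→L[ℝ] ℝ) : β = 0 := by
  ext v
  refine β.toAlternatingMap.map_linearDependent v fun hv => ?_
  have := hv.fintype_card_le_finrank
  rw [Fintype.card_fin] at this
  omega

theorem differentiableAt_pullback {W : Type*} [NormedAddCommGroup W] [NormedSpace ℝ W]
    {β : V → V [⋀^Fin n]→L[ℝ] ℝ} (p : W →L[ℝ] V) {x : W} (h : DifferentiableAt ℝ β (p x)) :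
    DifferentiableAt ℝ (fun y => (β (p y)).compContinuousLinearMap p) x := by
  have h1 : DifferentiableAt ℝ (fun y => β (p y)) x := h.comp x p.differentiableAt
  have h2 : Differentiable ℝ fun γ : V [⋀^Fin n]→L[ℝ] ℝ => compContinuousLinearMapCLM p γ := by
    fun_prop
  exact (h2 _).comp x h1

theorem extDeriv_pullback_clm {W : Type*} [NormedAddCommGroup W] [NormedSpace ℝ W]
    {β : V → V [⋀^Fin n]→L[ℝ] ℝ} (p : W →L[ℝ] V) {x : W} (h : DifferentiableAt ℝ β (p x))
    (h0 : extDeriv β (p x) = 0) :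
    extDeriv (fun y => (β (p y)).compContinuousLinearMap p) x = 0 := by
  have := extDeriv_pullback (r := ∞) h p.contDiff.contDiffAt (by
    rw [minSmoothness_of_isRCLikeNormedField]
    exact WithTop.coe_le_coe.mpr le_top)
  simp only [p.fderiv] at this
  rw [this, h0]
  rfl

end ExteriorDerivative

/-! ### The conformally scaled product of a Hermitian form with the Euclidean plane. -/

section ProductForm

open ContinuousAlternatingMap

/-- The Euclidean inner product of the complex plane. -/
noncomputable def planeForm : ℂ →L[ℝ] ℂ →L[ℝ] ℝ :=
  Complex.reCLM.smulRight Complex.reCLM + Complex.imCLM.smulRight Complex.imCLM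

theorem planeForm_apply (v w : ℂ) : planeForm v w = v.re * w.re + v.im * w.im := rfl

variable {E : Type*} [NormedAddCommGroup E] [NormedSpace ℝ E] {F : Type*} [NormedAddCommGroup F]
  [NormedSpace ℝ F]

/-- The form on `F ≅ E × ℂ` which is `c` times the product of `b` and the Euclidean form. -/
noncomputable def productForm (p : F →L[ℝ] E) (q : F →L[ℝ] ℂ) (c : ℝ) (b : E →L[ℝ] E →L[ℝ] ℝ) :
    F →L[ℝ] F →L[ℝ] ℝ :=
  c • (pullbackBilin p b + pullbackBilin q planeForm)

theorem productForm_apply (p : F →L[ℝ] E) (q : F →L[ℝ] ℂ) (c : ℝ) (b : E →L[ℝ] E →L[ℝ] ℝ)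
    (v w : F) : productForm p q c b v w = c * (b (p v) (p w) + planeForm (q v) (q w)) := rfl

variable [NormedSpace ℂ E] [IsScalarTower ℝ ℂ E] [NormedSpace ℂ F] [IsScalarTower ℝ ℂ F]

theorem contDiff_fundFormCLM {n : ℕ∞ω} :
    ContDiff ℝ n fun b : E →L[ℝ] E →L[ℝ] ℝ => fundFormCLM E b := by fun_prop

theorem isHermitianForm_planeForm : IsHermitianForm planeForm where
  symm v w := by
    rw [planeForm_apply, planeForm_apply]
    ring
  pos v hv := by
    rw [planeForm_apply, ← Complex.normSq_apply]
    exact Complex.normSq_pos.mpr hv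
  map_mulI v w := by
    simp only [planeForm_apply, mulI_apply, smul_eq_mul, Complex.mul_re, Complex.mul_im,
      Complex.I_re, Complex.I_im]
    ring

variable {p : F →L[ℝ] E} {q : F →L[ℝ] ℂ} {c : ℝ} {b : E →L[ℝ] E →L[ℝ] ℝ}

theorem isHermitianForm_productForm (hp : ∀ v, p (mulI F v) = mulI E (p v))
    (hq : ∀ v, q (mulI F v) = mulI ℂ (q v)) (hpq : ∀ v, p v = 0 → q v = 0 → v = 0) (hc : 0 < c)
    (hb : IsHermitianForm b) : IsHermitianForm (productForm p q c b) where
  symm v w := by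
    rw [productForm_apply, productForm_apply, hb.symm, isHermitianForm_planeForm.symm]
  pos v hv := by
    rw [productForm_apply]
    refine mul_pos hc ?_
    by_cases h : p v = 0
    · rw [h, _root_.map_zero, zero_add]
      exact isHermitianForm_planeForm.pos _ fun h' => hv (hpq v h h')
    · refine add_pos_of_pos_of_nonneg (hb.pos _ h) ?_
      rw [planeForm_apply]
      exact add_nonneg (mul_self_nonneg _) (mul_self_nonneg _)
  map_mulI v w := by
    rw [productForm_apply, productForm_apply, hp, hp, hq, hq, hb.map_mulI,
      isHermitianForm_planeForm.map_mulI]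
    ring

/-- The first real coordinate of the complex plane, sheared by `κ`. -/
noncomputable def shearCLM (κ : ℝ) : ℂ →L[ℝ] ℝ := Complex.reCLM - κ • Complex.imCLM

theorem shearCLM_apply (κ : ℝ) (z : ℂ) : shearCLM κ z = z.re - κ * z.im := rfl

/-- The fundamental form is p^*ω_{cb} + c dx ∧ dy, to which `wedgePower_add_wedge` applies. The
parameter κ is free since d(x - κ y) ∧ dy = dx ∧ dy; it will be chosen to make x - κ y the time
coordinate. Scaling the plane by the same c puts the mixed term in the form required by
`wedgePower_volumeFactor_smul`. -/
theorem wedgePower_productForm (hp : ∀ v, p (mulI F v) = mulI E (p v))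
    (hq : ∀ v, q (mulI F v) = mulI ℂ (q v)) (hpq : ∀ v, p v = 0 → q v = 0 → v = 0) (hc : 0 < c)
    (hb : IsHermitianForm b) (κ : ℝ) (k : ℕ) :
    wedgePower (fundFormCLM F (productForm p q c b)) (k + 1) =
      (wedgePower (fundFormCLM E (c • b)) (k + 1)).compContinuousLinearMap p +
        ((k : ℝ) + 1) • wedgeOne (n := 2 * k + 1) (shearCLM κ ∘L q)
          (wedgeOne (Complex.imCLM ∘L q)
            (c • (wedgePower (fundFormCLM E (c • b)) k).compContinuousLinearMap p)) := by
  have h := wedgePower_add_wedge (α := (fundFormCLM E (c • b)).compContinuousLinearMap p)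
    (α' := fundFormCLM F (productForm p q c b)) (σ := c • (shearCLM κ ∘L q))
    (θ := Complex.imCLM ∘L q) ?_ k
  · rw [h, wedgePower_compContinuousLinearMap, wedgePower_compContinuousLinearMap,
      smul_wedgeOne, wedgeOne_smul, wedgeOne_smul]
  · intro v
    ext w
    rw [(isHermitianForm_productForm hp hq hpq hc hb).contractTwo_fundFormCLM, productForm_apply]
    have h1 : contractTwo ((fundFormCLM E (c • b)).compContinuousLinearMap p) v w =
        c * b (mulI E (p v)) (p w) := by
      rw [contractTwo_apply, compContinuousLinearMap_apply, (hb.smul hc).fundFormCLM_apply]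
      rfl
    change _ = contractTwo _ v w + ((c * shearCLM κ (q v)) * (q w).im -
      (q v).im * (c * shearCLM κ (q w)))
    rw [h1, hp, hq, planeForm_apply, shearCLM_apply, shearCLM_apply]
    simp only [mulI_apply (E := ℂ), smul_eq_mul, Complex.mul_re, Complex.mul_im, Complex.I_re,
        Complex.I_im]
    ring

end ProductForm

/-! ### Translation-equivariant weights on the integers. -/

section Weights

/-- A smooth family of weights on the integers, equivariant under translation. -/
noncomputable def bumpWeight (s : ℝ) (i : ℤ) : ℝ :=
  (⟨1, 2, one_pos, one_lt_two⟩ : ContDiffBump (0 : ℝ)) (s - i)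

theorem contDiff_bumpWeight (i : ℤ) {n : ℕ∞} : ContDiff ℝ n fun s => bumpWeight s i :=
  (ContDiffBump.contDiff _).comp (contDiff_id.sub contDiff_const)

/-- One finite index set serves a whole neighbourhood of s₀, so locally all sums over ℤ are fixed
finite sums. A nonzero weight forces |s - i| < 2, hence |s₀ - i| < 3, and rounding s₀ down costs
less than 1 more. -/
theorem support_bumpWeight_subset {s₀ s : ℝ} (h : |s - s₀| < 1) :
    Function.support (bumpWeight s) ⊆ Finset.Icc (⌊s₀⌋ - 4) (⌊s₀⌋ + 4) := by
  intro i hi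
  have h1 : s - i ∈ Function.support (⟨1, 2, one_pos, one_lt_two⟩ : ContDiffBump (0 : ℝ)) := hi
  rw [ContDiffBump.support_eq, Metric.mem_ball, dist_zero_right, Real.norm_eq_abs] at h1
  have h2 := Int.floor_le s₀
  have h3 := Int.lt_floor_add_one s₀
  rw [abs_lt] at h h1
  change -(2 : ℝ) < _ ∧ _ < (2 : ℝ) at h1
  rw [Finset.coe_Icc, Set.mem_Icc]
  constructor
  · have : ((⌊s₀⌋ - 4 : ℤ) : ℝ) ≤ i := by
      push_cast
      linarith [h1.1, h1.2]
    exact_mod_cast this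
  · have : (i : ℝ) ≤ ((⌊s₀⌋ + 4 : ℤ) : ℝ) := by
      push_cast
      linarith [h1.1, h1.2]
    exact_mod_cast this

/-- The weights need not sum to 1: a common factor in them cancels from the volume-normalized mean.
-/
theorem isWeight_bumpWeight (s : ℝ) : IsWeight (bumpWeight s) where
  nonneg i := ContDiffBump.nonneg _
  exists_pos := by
    refine ⟨⌊s⌋, ContDiffBump.pos_of_mem_ball _ ?_⟩
    rw [Metric.mem_ball, dist_zero_right, Real.norm_eq_abs, abs_lt]
    have h2 := Int.floor_le s
    have h3 := Int.lt_floor_add_one s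
    change -(2 : ℝ) < _ ∧ _ < (2 : ℝ)
    constructor <;> linarith
  finite := (Finset.finite_toSet _).subset
    (support_bumpWeight_subset (s₀ := s) (by rw [sub_self, abs_zero]; exact one_pos))

end Weights

/-! ### The interpolating metric: smoothness and closedness of its codegree one power. -/

section SectionForm

open ContinuousAlternatingMap

variable {E : Type*} [NormedAddCommGroup E] [NormedSpace ℂ E] [NormedSpace ℝ E]
  [IsScalarTower ℝ ℂ E] [FiniteDimensional ℝ E] {F : Type*} [NormedAddCommGroup F]
  [NormedSpace ℝ F]

/-- The form on `F ≅ E × ℂ` interpolating, at the time `s`, between the forms `b i`. -/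
noncomputable def sectionForm (p : F →L[ℝ] E) (q : F →L[ℝ] ℂ) (s : ℝ)
    (b : ℤ → E →L[ℝ] E →L[ℝ] ℝ) : F →L[ℝ] F →L[ℝ] ℝ :=
  productForm p q (volumeFactor (b 0) b (bumpWeight s)) (meanForm b (bumpWeight s))

variable {p : F →L[ℝ] E} {q : F →L[ℝ] ℂ}

/-- Locally the mean is a finite sum. Inversion is smooth at invertible maps, and the power in
`volumeFactor` is smooth because the volume ratio is positive. -/
theorem ContDiffAt.sectionForm {X : Type*} [NormedAddCommGroup X] [NormedSpace ℝ X] {n : ℕ∞}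
    {b : ℤ → X → E →L[ℝ] E →L[ℝ] ℝ} {s : X → ℝ} {x : X} (hs : ContDiffAt ℝ n s x)
    (hb : ∀ i, ContDiffAt ℝ n (b i) x) (hb' : ∀ i, IsHermitianForm (b i x)) :
    ContDiffAt ℝ n (fun y => sectionForm p q (s y) fun i => b i y) x := by
  let w : X → ℤ → ℝ := fun y => bumpWeight (s y)
  have hw := isWeight_bumpWeight (s x)
  have hmean := isHermitianForm_meanForm hb' hw
  have hco := isHermitianCoform_meanCoform hb' hw
  have h1 : ContDiffAt ℝ n (fun y => meanCoform (fun i => b i y) (w y)) x := by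
    have hev : (fun y => meanCoform (fun i => b i y) (w y)) =ᶠ[𝓝 x]
        fun y => ∑ i ∈ Finset.Icc (⌊s x⌋ - 4) (⌊s x⌋ + 4),
          (w y i • ContinuousLinearMap.id ℝ E) ∘L (b i y).inverse := by
      have h2 : ∀ᶠ y in 𝓝 x, |s y - s x| < 1 :=
        hs.continuousAt (Metric.ball_mem_nhds (s x) one_pos)
      filter_upwards [h2] with y hy
      rw [meanCoform_eq_sum _ (support_bumpWeight_subset hy)]
      rfl
    refine ContDiffAt.congr_of_eventuallyEq (ContDiffAt.sum fun i _ => ?_) hev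
    have h3 : ContDiffAt ℝ n (fun y => (b i y).inverse) x := by
      obtain ⟨e, he⟩ := (hb' i).isInvertible
      have h4 := contDiffAt_map_inverse (𝕜 := ℝ) (n := n) e
      rw [he] at h4
      exact h4.comp x (hb i)
    have h4 : ContDiffAt ℝ n (fun y => w y i) x :=
      (contDiff_bumpWeight i).contDiffAt.comp x hs
    exact (h4.smul contDiffAt_const).clm_comp h3
  have h2 : ContDiffAt ℝ n (fun y => meanForm (fun i => b i y) (w y)) x := by
    obtain ⟨e, he⟩ := hco.isInvertible
    have h4 := contDiffAt_map_inverse (𝕜 := ℝ) (n := n) e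
    rw [he] at h4
    exact h4.comp x h1
  have htop {g : X → E →L[ℝ] E →L[ℝ] ℝ} (hg : ContDiffAt ℝ n g x) :
      ContDiffAt ℝ n (fun y => topPower (g y) (realBasis E)) x := by
    have h3 : ContDiffAt ℝ n (fun y => fundFormCLM E (g y)) x :=
      contDiff_fundFormCLM.contDiffAt.comp x hg
    have h4 : ContDiffAt ℝ n (fun y => topPower (g y)) x :=
      (contDiff_wedgePower _).contDiffAt.comp x h3
    have h5 : ContDiff ℝ n fun β : E [⋀^Fin (2 * Module.finrank ℂ E)]→L[ℝ] ℝ =>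
      ContinuousAlternatingMap.apply ℝ E ℝ (realBasis E) β := by fun_prop
    exact h5.contDiffAt.comp x h4
  have h3 : ContDiffAt ℝ n (fun y => volumeFactor (b 0 y) (fun i => b i y) (w y)) x :=
    ((htop h2).div (htop (hb 0)) (apply_realBasis_ne_zero
        (hb' 0).topPower_ne_zero)).rpow_const_of_ne
      ((hb' 0).topPower_div_pos hmean).ne'
  refine h3.smul_bilin (ContDiffAt.add ?_ contDiffAt_const)
  exact contDiffAt_const.clm_comp (h2.clm_comp contDiffAt_const)

variable [NormedSpace ℂ F] [IsScalarTower ℝ ℂ F]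

theorem isHermitianForm_sectionForm (hp : ∀ v, p (mulI F v) = mulI E (p v))
    (hq : ∀ v, q (mulI F v) = mulI ℂ (q v)) (hpq : ∀ v, p v = 0 → q v = 0 → v = 0) (s : ℝ)
    {b : ℤ → E →L[ℝ] E →L[ℝ] ℝ} (hb : ∀ i, IsHermitianForm (b i)) :
    IsHermitianForm (sectionForm p q s b) :=
  isHermitianForm_productForm hp hq hpq (volumeFactor_pos (hb 0) hb (isWeight_bumpWeight s))
    (isHermitianForm_meanForm hb (isWeight_bumpWeight s))

/-- The volume normalization makes the first summand independent of s, and the linearity in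
`wedgePower_volumeFactor_smul` turns the second into a weighted sum of the individual powers. -/
theorem wedgePower_sectionForm (hp : ∀ v, p (mulI F v) = mulI E (p v))
    (hq : ∀ v, q (mulI F v) = mulI ℂ (q v)) (hpq : ∀ v, p v = 0 → q v = 0 → v = 0) (κ : ℝ)
    {k : ℕ} (hk : Module.finrank ℂ E = k + 1) (s : ℝ) {b : ℤ → E →L[ℝ] E →L[ℝ] ℝ}
    (hb : ∀ i, IsHermitianForm (b i)) (hvol : ∀ i, topPower (b i) = topPower (b 0))
    {S : Finset ℤ} (hS : Function.support (bumpWeight s) ⊆ S) :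
    wedgePower (fundFormCLM F (sectionForm p q s b)) (k + 1) =
      (wedgePower (fundFormCLM E (b 0)) (k + 1)).compContinuousLinearMap p +
        ∑ i ∈ S, ((k : ℝ) + 1) • wedgeOne (n := 2 * k + 1) (shearCLM κ ∘L q)
          (wedgeOne (Complex.imCLM ∘L q) (bumpWeight s i •
            (wedgePower (fundFormCLM E (b i)) k).compContinuousLinearMap p)) := by
  have hw := isWeight_bumpWeight s
  have htop := topPower_volumeFactor_smul (hb 0) hb hw
  rw [topPower, topPower, hk] at htop
  have h0 := wedgePower_volumeFactor_smul hk (hb 0) hb hvol hw hS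
  rw [sectionForm, wedgePower_productForm hp hq hpq (volumeFactor_pos (hb 0) hb hw)
    (isHermitianForm_meanForm hb hw) κ k, htop]
  generalize fundFormCLM E (volumeFactor (b 0) b (bumpWeight s) • meanForm b (bumpWeight s)) = α
    at h0 ⊢
  have h1 := congrArg (compContinuousLinearMapCLM p) h0
  rw [_root_.map_smul, _root_.map_sum] at h1
  simp only [_root_.map_smul] at h1
  have h2 := congrArg (fun γ => ((k : ℝ) + 1) • wedgeOneCLM (n := 2 * k + 1) (shearCLM κ ∘L q)
    (wedgeOneCLM (Complex.imCLM ∘L q) γ)) h1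
  simp only [_root_.map_sum, Finset.smul_sum] at h2
  rw [add_right_inj]
  exact h2

/-- The codegree one power of the fundamental form of the interpolating form is closed. -/
theorem closed_wedgePower_sectionForm (hp : ∀ v, p (mulI F v) = mulI E (p v))
    (hq : ∀ v, q (mulI F v) = mulI ℂ (q v)) (hpq : ∀ v, p v = 0 → q v = 0 → v = 0) (κ : ℝ)
    {k : ℕ} (hk : Module.finrank ℂ E = k + 1) {b : ℤ → E → E →L[ℝ] E →L[ℝ] ℝ} {U : Set E}
    (hU : IsOpen U) (hb : ∀ i, ∀ y ∈ U, IsHermitianForm (b i y))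
    (hvol : ∀ i, ∀ y ∈ U, topPower (b i y) = topPower (b 0 y))
    (hd : ∀ y ∈ U, DifferentiableAt ℝ (b 0) y)
    (hcl : ∀ i, ∀ y ∈ U, DifferentiableAt ℝ (fun y => wedgePower (fundFormCLM E (b i y)) k) y ∧
      extDeriv (fun y => wedgePower (fundFormCLM E (b i y)) k) y = 0) {x : F} (hx : p x ∈ U) :
    DifferentiableAt ℝ (fun y => wedgePower (fundFormCLM F (sectionForm p q
        (shearCLM κ (q y)) fun i => b i (p y))) (k + 1)) x ∧
      extDeriv (fun y => wedgePower (fundFormCLM F (sectionForm p q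
        (shearCLM κ (q y)) fun i => b i (p y))) (k + 1)) x = 0 := by
  set σ : F →L[ℝ] ℝ := shearCLM κ ∘L q with hσ
  let S : Finset ℤ := Finset.Icc (⌊σ x⌋ - 4) (⌊σ x⌋ + 4)
  let Ω : F → F [⋀^Fin (2 * (k + 1))]→L[ℝ] ℝ := fun y =>
    (wedgePower (fundFormCLM E (b 0 (p y))) (k + 1)).compContinuousLinearMap p
  let T : ℤ → F → F [⋀^Fin (2 * k + 1 + 1)]→L[ℝ] ℝ := fun i y =>
    wedgeOne σ (wedgeOne (Complex.imCLM ∘L q) (bumpWeight (σ y) i •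
      (wedgePower (fundFormCLM E (b i (p y))) k).compContinuousLinearMap p))
  have hev : (fun y => wedgePower (fundFormCLM F (sectionForm p q
      (shearCLM κ (q y)) fun i => b i (p y))) (k + 1)) =ᶠ[𝓝 x]
        fun y => Ω y + ∑ i ∈ S, ((k : ℝ) + 1) • T i y := by
    have h1 : ∀ᶠ y in 𝓝 x, p y ∈ U := p.continuous.continuousAt (hU.mem_nhds hx)
    have h2 : ∀ᶠ y in 𝓝 x, |σ y - σ x| < 1 :=
      σ.continuous.continuousAt (Metric.ball_mem_nhds (σ x) one_pos)
    filter_upwards [h1, h2] with y hy hy'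
    exact wedgePower_sectionForm hp hq hpq κ hk _ (fun i => hb i _ hy) (fun i => hvol i _ hy)
      (support_bumpWeight_subset hy')
  have hΩ' : DifferentiableAt ℝ (fun y => wedgePower (fundFormCLM E (b 0 y)) (k + 1)) (p x) := by
    have h1 : DifferentiableAt ℝ (fun y => fundFormCLM E (b 0 y)) (p x) :=
      ((contDiff_fundFormCLM (n := 1)).differentiable one_ne_zero _).comp _ (hd _ hx)
    exact ((contDiff_wedgePower (k + 1) (N := 1)).differentiable one_ne_zero _).comp _ h1
  -- Before the pullback this form has top degree on E, so its exterior derivative has degree above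
  -- the real dimension and vanishes.
  have hΩ : DifferentiableAt ℝ Ω x ∧ extDeriv Ω x = 0 := by
    refine ⟨differentiableAt_pullback p hΩ', extDeriv_pullback_clm p hΩ' ?_⟩
    refine continuousAlternatingMap_eq_zero_of_finrank_lt ?_ _
    rw [← Module.finrank_mul_finrank ℝ ℂ E, Complex.finrank_real_complex, hk]
    omega
  have hT (i : ℤ) : DifferentiableAt ℝ (T i) x ∧ extDeriv (T i) x = 0 :=
    extDeriv_wedgeOne_wedgeOne_smul σ (Complex.imCLM ∘L q) (ρ := fun s => bumpWeight s i)
      ((contDiff_bumpWeight i (n := 1)).differentiable one_ne_zero _)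
      (differentiableAt_pullback p (hcl i _ hx).1)
      (extDeriv_pullback_clm p (hcl i _ hx).1 (hcl i _ hx).2)
  have hsum (S : Finset ℤ) :
      DifferentiableAt ℝ (fun y => Ω y + ∑ i ∈ S, ((k : ℝ) + 1) • T i y) x ∧
        extDeriv (fun y => Ω y + ∑ i ∈ S, ((k : ℝ) + 1) • T i y) x = 0 := by
    classical
    induction S using Finset.induction_on with
    | empty => simpa using hΩ
    | insert i S hi ih =>
      have h1 : DifferentiableAt ℝ (fun y => ((k : ℝ) + 1) • T i y) x :=
        (hT i).1.fun_const_smul _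
      have h2 : extDeriv (fun y => ((k : ℝ) + 1) • T i y) x = 0 := by
        change extDeriv (((k : ℝ) + 1) • T i) x = 0
        rw [extDeriv_smul, (hT i).2, smul_zero]
      have e : (fun y => Ω y + ∑ j ∈ insert i S, ((k : ℝ) + 1) • T j y) =
          fun y => (((k : ℝ) + 1) • T i y) + (Ω y + ∑ j ∈ S, ((k : ℝ) + 1) • T j y) := by
        ext1 y
        rw [Finset.sum_insert hi]
        exact add_left_comm _ _ _
      rw [e]
      refine ⟨h1.add ih.1, ?_⟩
      rw [extDeriv_fun_add h1 ih.1, h2, ih.2, add_zero]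
  exact ⟨(hsum S).1.congr_of_eventuallyEq hev, hev.extDeriv_eq.trans (hsum S).2⟩

end SectionForm

/-! ### Equivariance of the construction under linear isomorphisms and shifts of the index. -/

section Naturality

variable {E : Type*} [NormedAddCommGroup E] [NormedSpace ℝ E] {ι : Type*}

theorem inverse_pullbackBilin (D : E ≃L[ℝ] E) (b : E →L[ℝ] E →L[ℝ] ℝ) :
    (pullbackBilin (D : E →L[ℝ] E) b).inverse =
      (D.symm : E →L[ℝ] E) ∘L b.inverse ∘L
        ((D.symm.arrowCongr (ContinuousLinearEquiv.refl ℝ ℝ)).symm :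
          (E →L[ℝ] ℝ) →L[ℝ] E →L[ℝ] ℝ) := by
  have h : pullbackBilin (D : E →L[ℝ] E) b =
      ((D.symm.arrowCongr (ContinuousLinearEquiv.refl ℝ ℝ)) :
        (E →L[ℝ] ℝ) →L[ℝ] E →L[ℝ] ℝ) ∘L (b ∘L (D : E →L[ℝ] E)) := by
    ext v w
    rfl
  rw [h, ContinuousLinearMap.inverse_equiv_comp, ContinuousLinearMap.inverse_comp_equiv,
    ContinuousLinearMap.comp_assoc]

theorem meanForm_pullbackBilin (D : E ≃L[ℝ] E) (b : ι → E →L[ℝ] E →L[ℝ] ℝ) {w : ι → ℝ}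
    (hw : (Function.support w).Finite) :
    meanForm (fun i => pullbackBilin (D : E →L[ℝ] E) (b i)) w =
      pullbackBilin (D : E →L[ℝ] E) (meanForm b w) := by
  have h : meanCoform (fun i => pullbackBilin (D : E →L[ℝ] E) (b i)) w =
      (D.symm : E →L[ℝ] E) ∘L (meanCoform b w ∘L
        ((D.symm.arrowCongr (ContinuousLinearEquiv.refl ℝ ℝ)).symm :
          (E →L[ℝ] ℝ) →L[ℝ] E →L[ℝ] ℝ)) := by
    rw [meanCoform_eq_sum _ hw.coe_toFinset.ge, meanCoform_eq_sum _ hw.coe_toFinset.ge]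
    simp only [inverse_pullbackBilin]
    ext ξ
    simp
  rw [meanForm, h, ContinuousLinearMap.inverse_equiv_comp, ContinuousLinearMap.inverse_comp_equiv]
  ext v w
  rfl

theorem meanForm_comp_equiv (b : ι → E →L[ℝ] E →L[ℝ] ℝ) (w : ι → ℝ) (σ : ι ≃ ι) :
    meanForm (fun i => b (σ i)) (fun i => w (σ i)) = meanForm b w := by
  rw [meanForm, meanForm, meanCoform, meanCoform]
  congr 1
  exact finsum_comp_equiv σ (f := fun i => w i • (b i).inverse)

variable [NormedSpace ℂ E] [IsScalarTower ℝ ℂ E]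

theorem topPower_pullbackBilin {D : E →L[ℝ] E} (hD : ∀ v, D (mulI E v) = mulI E (D v))
    (b : E →L[ℝ] E →L[ℝ] ℝ) :
    topPower (pullbackBilin D b) = (topPower b).compContinuousLinearMap D := by
  rw [topPower, topPower, fundFormCLM_pullbackBilin D hD, wedgePower_compContinuousLinearMap]

variable [FiniteDimensional ℝ E]

/-- Top-degree forms are proportional, and pulling both back by D preserves their ratio. -/
theorem volumeFactor_pullbackBilin {D : E ≃L[ℝ] E} (hD : ∀ v, D (mulI E v) = mulI E (D v))
    {b₀ : E →L[ℝ] E →L[ℝ] ℝ} (hb₀ : IsHermitianForm b₀) (b : ι → E →L[ℝ] E →L[ℝ] ℝ) {w : ι → ℝ}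
    (hw : (Function.support w).Finite) :
    volumeFactor (pullbackBilin (D : E →L[ℝ] E) b₀)
      (fun i => pullbackBilin (D : E →L[ℝ] E) (b i)) w = volumeFactor b₀ b w := by
  have h₀ : topPower (pullbackBilin (D : E →L[ℝ] E) b₀) (realBasis E) ≠ 0 :=
    apply_realBasis_ne_zero (hb₀.pullbackBilin hD D.injective).topPower_ne_zero
  rw [volumeFactor, volumeFactor, meanForm_pullbackBilin D b hw]
  congr 1
  rw [div_eq_iff h₀, topPower_pullbackBilin hD, topPower_pullbackBilin hD]
  exact congrArg (fun A => A ((D : E →L[ℝ] E) ∘ realBasis E))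
    (eq_smul_of_ne_zero hb₀.topPower_ne_zero (topPower (meanForm b w)))

theorem bumpWeight_add_intCast (s : ℝ) (i n : ℤ) : bumpWeight (s + n) (i + n) = bumpWeight s i := by
  rw [bumpWeight, bumpWeight]
  congr 1
  push_cast
  ring

/-- The interpolating forms are equivariant under a simultaneous shift of the time and of the
sequence of forms. -/
theorem pullbackBilin_sectionForm {F : Type*} [NormedAddCommGroup F] [NormedSpace ℝ F]
    {p : F →L[ℝ] E} {q : F →L[ℝ] ℂ} {P : F →L[ℝ] F} {D : E ≃L[ℝ] E}
    (hD : ∀ v, D (mulI E v) = mulI E (D v)) (hp : ∀ v, p (P v) = D (p v))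
    (hq : ∀ v, q (P v) = q v) {b b' : ℤ → E →L[ℝ] E →L[ℝ] ℝ} {n : ℤ}
    (hb : ∀ i, b i = pullbackBilin (D : E →L[ℝ] E) (b' (i + n)))
    (hb' : IsHermitianForm (b' n)) (hvol : ∀ i, topPower (b' i) = topPower (b' 0)) (s : ℝ) :
    pullbackBilin P (sectionForm p q (s + n) b') = sectionForm p q s b := by
  have hw : bumpWeight s = fun i => bumpWeight (s + n) (Equiv.addRight n i) :=
    funext fun i => (bumpWeight_add_intCast s i n).symm
  have hfin := (isWeight_bumpWeight s).finite
  have h1 : meanForm b (bumpWeight s) =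
      pullbackBilin (D : E →L[ℝ] E) (meanForm b' (bumpWeight (s + n))) := by
    rw [show b = _ from funext hb, meanForm_pullbackBilin D _ hfin, hw]
    congr 1
    exact meanForm_comp_equiv b' _ (Equiv.addRight n)
  -- The shift changes the reference form from `b' 0` to `b' n`; the factor is unaffected because
  -- their volumes agree.
  have h2 : volumeFactor (b 0) b (bumpWeight s) = volumeFactor (b' 0) b' (bumpWeight (s + n)) := by
    rw [show b = _ from funext hb]
    dsimp only
    rw [zero_add, volumeFactor_pullbackBilin hD hb' _ hfin, volumeFactor, volumeFactor, hvol n, hw]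
    congr 4
    exact meanForm_comp_equiv b' _ (Equiv.addRight n)
  ext v w
  rw [pullbackBilin_apply, sectionForm, sectionForm, productForm_apply, productForm_apply, hp, hp,
    hq, hq, h1, h2]
  rfl

end Naturality

/-! ### Smoothness of a metric in terms of its pullbacks to vector spaces. -/

section PullbackFamily

open Bundle

variable {E : Type*} [NormedAddCommGroup E] [NormedSpace ℂ E]
  {X : Type*} [TopologicalSpace X] [ChartedSpace E X] [IsManifold 𝓘(ℂ, E) ω X]
  {F : Type*} [NormedAddCommGroup F] [NormedSpace ℝ F]

variable (F) in
/-- The pullback, under a map defined on a vector space, of a family of bilinear forms on the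
tangent spaces. -/
noncomputable def pullbackFamily {N : Type*} [TopologicalSpace N] [ChartedSpace F N] (u : N → X)
    (b : X → E →L[ℝ] E →L[ℝ] ℝ) (y : N) :
    F →L[ℝ] F →L[ℝ] ℝ :=
  pullbackBilin (mfderiv 𝓘(ℝ, F) 𝓘(ℝ, E) u y : F →L[ℝ] E) (b (u y))

theorem ContMDiffOn.pullbackFamily [FiniteDimensional ℝ F] {u : F → X} {U : Set F} (hU : IsOpen U)
    (hu : ContMDiffOn 𝓘(ℝ, F) 𝓘(ℝ, E) ∞ u U) {b : ∀ x : X, TangentSpace 𝓘(ℝ, E) x →L[ℝ]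
        TangentSpace 𝓘(ℝ, E) x →L[ℝ] ℝ}
    (hb : ContMDiff 𝓘(ℝ, E) (𝓘(ℝ, E).prod 𝓘(ℝ, E →L[ℝ] E →L[ℝ] ℝ)) ∞
      (fun x ↦ TotalSpace.mk' (E →L[ℝ] E →L[ℝ] ℝ) (E := fun x : X => TangentSpace 𝓘(ℝ, E) x →L[ℝ]
          TangentSpace 𝓘(ℝ, E) x →L[ℝ] ℝ) x (b x))) :
    ContDiffOn ℝ ∞ (pullbackFamily F u b) U := by
  have hv (v : F) : ContMDiffOn 𝓘(ℝ, F) (𝓘(ℝ, E).tangent) ∞ (fun y => (TotalSpace.mk' E (u y)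
      (mfderiv 𝓘(ℝ, F) 𝓘(ℝ, E) u y v) : TangentBundle 𝓘(ℝ, E) X)) U := by
    have h := hu.contMDiffOn_tangentMapWithin (m := ∞) le_rfl hU.uniqueMDiffOn
    have h2 : ContMDiff 𝓘(ℝ, F) (𝓘(ℝ, F).tangent) ∞ (fun y => (TotalSpace.mk' F y v :
        TangentBundle 𝓘(ℝ, F) F)) := by
      intro y
      exact contMDiffAt_vectorSpace_iff_contDiffAt.mpr contDiffAt_const
    refine (h.comp h2.contMDiffOn (fun y hy => hy)).congr fun y hy => ?_
    rw [Function.comp_apply, tangentMapWithin, mfderivWithin_of_isOpen hU hy]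
  refine contDiffOn_clm_apply.mpr fun v => contDiffOn_clm_apply.mpr fun w => ?_
  have h3 := ContMDiffOn.clm_bundle_apply₂ (F₁ := E) (F₂ := E) (F₃ := ℝ) (E₃ := Bundle.Trivial X ℝ)
      (hb.comp_contMDiffOn hu) (hv v) (hv w)
  intro y hy
  have h4 := h3 y hy
  simp only [contMDiffWithinAt_totalSpace] at h4
  exact h4.2.contDiffWithinAt

/-- The inverse of the tangent bundle trivialization at x₀ is the differential of the inverse chart.
The section in bundle coordinates is therefore the pullback of b under that inverse chart. -/
theorem contMDiffAt_of_pullbackFamily [FiniteDimensional ℝ E]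
    {b : ∀ x : X, TangentSpace 𝓘(ℝ, E) x →L[ℝ] TangentSpace 𝓘(ℝ, E) x →L[ℝ] ℝ}
    {x₀ : X} (h : ContDiffAt ℝ ∞ (pullbackFamily E (chartAt E x₀).symm b) (chartAt E x₀ x₀)) :
    ContMDiffAt 𝓘(ℝ, E) (𝓘(ℝ, E).prod 𝓘(ℝ, E →L[ℝ] E →L[ℝ] ℝ)) ∞
      (fun x ↦ TotalSpace.mk' (E →L[ℝ] E →L[ℝ] ℝ) (E := fun x : X => TangentSpace 𝓘(ℝ, E) x →L[ℝ]
          TangentSpace 𝓘(ℝ, E) x →L[ℝ] ℝ) x (b x)) x₀ := by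
  rw [contMDiffAt_section]
  have h1 : ContMDiffAt 𝓘(ℝ, E) 𝓘(ℝ, E →L[ℝ] E →L[ℝ] ℝ) ∞ (fun x => pullbackFamily E
      (chartAt E x₀).symm b (chartAt E x₀ x)) x₀ :=
    h.contMDiffAt.comp x₀ (contMDiffAt_of_mem_maximalAtlas (IsManifold.chart_mem_maximalAtlas x₀)
        (mem_chart_source E x₀))
  refine h1.congr_of_eventuallyEq ?_
  filter_upwards [(chartAt E x₀).open_source.mem_nhds (mem_chart_source E x₀)] with x hx
  have h2 : (trivializationAt E (TangentSpace 𝓘(ℝ, E)) x₀).symmL ℝ x = (mfderiv 𝓘(ℝ, E) 𝓘(ℝ, E)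
      (chartAt E x₀).symm (chartAt E x₀ x) : E →L[ℝ] E) := by
    have := TangentBundle.symmL_trivializationAt (I := 𝓘(ℝ, E)) hx
    simpa [mfld_simps] using this
  rw [hom_trivializationAt_apply]
  ext v w
  have h3 := inCoordinates_apply_eq₂ (F₁ := E) (F₂ := E) (F₃ := ℝ) (E₁ := fun x :
      X => TangentSpace 𝓘(ℝ, E) x) (E₂ := fun x : X => TangentSpace 𝓘(ℝ, E) x) (E₃ :=
      Bundle.Trivial X ℝ) (x₀ := x₀) (x := x) (v := v) (w := w) (ϕ := b x) hx hx (by simp)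
  have h4 (t : ℝ) :
      (trivializationAt ℝ (Bundle.Trivial X ℝ) x₀).linearMapAt ℝ x t = t := by simp
  have h5 (v : E) : (trivializationAt E (TangentSpace 𝓘(ℝ, E)) x₀).symm x v =
      (mfderiv 𝓘(ℝ, E) 𝓘(ℝ, E) (chartAt E x₀).symm (chartAt E x₀ x) : E →L[ℝ] E) v :=
    (Bundle.Trivialization.symmL_apply (R := ℝ) _ hx _).symm.trans (DFunLike.congr_fun h2 v)
  have h6 (x' : X) (v w : E) (hx' : x' = x) : b x v w = b x' v w := by rw [hx']
  refine h3.trans ((h4 _).trans ?_)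
  refine Eq.trans ?_ (h6 _ _ _ ((chartAt E x₀).left_inv hx))
  exact congrArg₂ (fun v w : E => b x v w) (h5 v) (h5 w)

end PullbackFamily

/-! ### Real differentials of holomorphic maps and pullbacks of closed forms. -/

section PullbackForm

variable {E : Type*} [NormedAddCommGroup E] [NormedSpace ℂ E]
  {X : Type*} [TopologicalSpace X] [ChartedSpace E X]
  {F : Type*} [NormedAddCommGroup F] [NormedSpace ℂ F]
  {N : Type*} [TopologicalSpace N] [ChartedSpace F N]

theorem HasMFDerivAt.restrictScalars_real {u : N → X} {y : N} {D : F →L[ℂ] E}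
    (h : HasMFDerivAt 𝓘(ℂ, F) 𝓘(ℂ, E) u y D) :
    HasMFDerivAt 𝓘(ℝ, F) 𝓘(ℝ, E) u y (D.restrictScalars ℝ : F →L[ℝ] E) := by
  have h2 : HasFDerivWithinAt (𝕜 := ℂ) (E := F) (F := E) _ D _ _ := h.2
  exact ⟨h.1, h2.restrictScalars ℝ⟩

theorem MDifferentiableAt.restrictScalars_real {u : N → X} {y : N}
    (h : MDifferentiableAt 𝓘(ℂ, F) 𝓘(ℂ, E) u y) : MDifferentiableAt 𝓘(ℝ, F) 𝓘(ℝ, E) u y :=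
  (HasMFDerivAt.restrictScalars_real h.hasMFDerivAt).mdifferentiableAt

theorem mfderiv_real_mulI {u : N → X} {y : N} (h : MDifferentiableAt 𝓘(ℂ, F) 𝓘(ℂ, E) u y) (v : F) :
    (mfderiv 𝓘(ℝ, F) 𝓘(ℝ, E) u y : F →L[ℝ] E) (mulI F v) =
      mulI E ((mfderiv 𝓘(ℝ, F) 𝓘(ℝ, E) u y : F →L[ℝ] E) v) := by
  rw [(HasMFDerivAt.restrictScalars_real h.hasMFDerivAt).mfderiv]
  exact map_smul (mfderiv 𝓘(ℂ, F) 𝓘(ℂ, E) u y : F →L[ℂ] E) Complex.I v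

theorem ContMDiffOn.restrictScalars_real [IsManifold 𝓘(ℂ, E) ω X] {u : F → X} {U : Set F}
    (h : ContMDiffOn 𝓘(ℂ, F) 𝓘(ℂ, E) ω u U) : ContMDiffOn 𝓘(ℝ, F) 𝓘(ℝ, E) ∞ u U := by
  intro y hy
  obtain ⟨h1, h2⟩ := h y hy
  refine ⟨h1, ?_⟩
  exact (ContDiffWithinAt.restrict_scalars ℝ h2).of_le le_top

variable {F : Type*} [NormedAddCommGroup F] [NormedSpace ℝ F] {N : Type*} [TopologicalSpace N]
    [ChartedSpace F N] {F' : Type*} [NormedAddCommGroup F'] [NormedSpace ℝ F'] {N' : Type*}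
    [TopologicalSpace N'] [ChartedSpace F' N']

theorem pullbackFamily_comp [IsManifold 𝓘(ℂ, E) ω X] {u : N → N'} {v : N' → X}
    (b : X → E →L[ℝ] E →L[ℝ] ℝ) {y : N} (hv : MDifferentiableAt 𝓘(ℝ, F') 𝓘(ℝ, E) v (u y))
    (hu : MDifferentiableAt 𝓘(ℝ, F) 𝓘(ℝ, F') u y) :
    pullbackFamily F (v ∘ u) b y =
      pullbackBilin (F := F) (F' := F') (mfderiv 𝓘(ℝ, F) 𝓘(ℝ, F') u y : F →L[ℝ] F')
        (pullbackFamily F' v b (u y)) := by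
  have h : (mfderiv 𝓘(ℝ, F) 𝓘(ℝ, E) (v ∘ u) y : F →L[ℝ] E) =
      (mfderiv 𝓘(ℝ, F') 𝓘(ℝ, E) v (u y) : F' →L[ℝ] E) ∘L
        (mfderiv 𝓘(ℝ, F) 𝓘(ℝ, F') u y : F →L[ℝ] F') := mfderiv_comp y hv hu
  rw [pullbackFamily, h]
  rfl

/-- The pullback of a form under a map defined on a vector space. -/
noncomputable def FormFamily.pullback {n : ℕ} (α : FormFamily E X n) (u : F → X) (y : F) :
    F [⋀^Fin n]→L[ℝ] ℝ :=
  ContinuousAlternatingMap.compContinuousLinearMap (M := E) (α (u y)) (mfderiv 𝓘(ℝ, F) 𝓘(ℝ, E) u y :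
      F →L[ℝ] E)

theorem FormFamily.pullback_comp {n : ℕ} {u : F → F'} {v : F' → X} (α : FormFamily E X n) {y : F}
    (hv : MDifferentiableAt 𝓘(ℝ, F') 𝓘(ℝ, E) v (u y)) (hu : DifferentiableAt ℝ u y) :
    α.pullback (v ∘ u) y = (α.pullback v (u y)).compContinuousLinearMap (fderiv ℝ u y) := by
  have h : (mfderiv 𝓘(ℝ, F) 𝓘(ℝ, E) (v ∘ u) y : F →L[ℝ] E) =
      (mfderiv 𝓘(ℝ, F') 𝓘(ℝ, E) v (u y) : F' →L[ℝ] E) ∘L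
        (mfderiv 𝓘(ℝ, F) 𝓘(ℝ, F') u y : F →L[ℝ] F') := mfderiv_comp y hv hu.mdifferentiableAt
  rw [mfderiv_eq_fderiv] at h
  rw [FormFamily.pullback, h]
  rfl

theorem FormFamily.pullback_congr {n : ℕ} {u v : F → X} (α : FormFamily E X n) {y : F} (h :
    u =ᶠ[𝓝 y] v) : α.pullback u y = α.pullback v y := by
  have h1 : (mfderiv 𝓘(ℝ, F) 𝓘(ℝ, E) u y : F →L[ℝ] E) = mfderiv 𝓘(ℝ, F) 𝓘(ℝ, E) v y := h.mfderiv_eq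
  let β : X → E [⋀^Fin n]→L[ℝ] ℝ := α
  change (β (u y)).compContinuousLinearMap _ = (β (v y)).compContinuousLinearMap _
  rw [h1, h.eq_of_nhds]

/-- The pullback of a closed form. -/
theorem FormFamily.IsClosed.pullback {n : ℕ} {α : FormFamily E X n} (hα : α.IsClosed)
    [IsManifold 𝓘(ℂ, E) ω X] {u : F → X} {U : Set F} (hU : IsOpen U)
    (hu : ContMDiffOn 𝓘(ℝ, F) 𝓘(ℝ, E) ∞ u U) {y : F} (hy : y ∈ U) :
    DifferentiableAt ℝ (α.pullback u) y ∧ extDeriv (α.pullback u) y = 0 := by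
  set c := chartAt E (u y) with hc
  have hcs : u y ∈ c.source := mem_chart_source E (u y)
  obtain ⟨h1, h2⟩ := hα c (chart_mem_atlas E (u y))
  have hum {z : F} (hz : z ∈ U) := hu.contMDiffAt (hU.mem_nhds hz)
  have hψ {z : F} (hz : z ∈ U) (hz' : u z ∈ c.source) : ContDiffAt ℝ ∞ (c ∘ u) z := by
    rw [← contMDiffAt_iff_contDiffAt]
    exact (contMDiffAt_of_mem_maximalAtlas (IsManifold.chart_mem_maximalAtlas (u y)) hz').comp z
      (hum hz)
  have hd : DifferentiableAt ℝ (α.inChart c) ((c ∘ u) y) :=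
    h1.differentiableAt (c.open_target.mem_nhds (c.map_source hcs))
  have hnear {z : F} (hz : z ∈ U) (hz' : u z ∈ c.source) :
      ∀ᶠ z' in 𝓝 z, z' ∈ U ∧ u z' ∈ c.source :=
    Filter.Eventually.and (hU.mem_nhds hz) ((hum hz).continuousAt (c.open_source.mem_nhds hz'))
  -- Factoring u through the chart c turns this into a pullback between vector spaces, where
  -- naturality of d is available.
  have hev : α.pullback u =ᶠ[𝓝 y]
      fun z => (α.inChart c ((c ∘ u) z)).compContinuousLinearMap (fderiv ℝ (c ∘ u) z) := by
    filter_upwards [hnear hy hcs] with z ⟨hz, hz'⟩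
    have h3 : u =ᶠ[𝓝 z] c.symm ∘ (c ∘ u) := by
      filter_upwards [hnear hz hz'] with z' hz''
      exact (c.left_inv hz''.2).symm
    rw [α.pullback_congr h3, α.pullback_comp _ ((hψ hz hz').differentiableAt (by simp))]
    · rfl
    · exact mdifferentiableAt_atlas_symm (chart_mem_atlas E (u y)) (c.map_source hz')
  have hψ' : DifferentiableAt ℝ (fderiv ℝ (c ∘ u)) y :=
    ((hψ hy hcs).fderiv_right (m := 1) (by norm_cast)).differentiableAt one_ne_zero
  refine ⟨((hd.comp y ((hψ hy hcs).differentiableAt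
    (by simp))).continuousAlternatingMapCompContinuousLinearMap hψ').congr_of_eventuallyEq hev, ?_⟩
  rw [hev.extDeriv_eq, extDeriv_pullback hd (hψ hy hcs)]
  · exact congrArg (fun β => ContinuousAlternatingMap.compContinuousLinearMap β _)
      (h2 _ (c.map_source hcs))
  · rw [minSmoothness_of_isRCLikeNormedField]
    exact WithTop.coe_le_coe.mpr le_top

end PullbackForm

/-! ### The transported metrics (f^{-k})^* g, all balanced and of equal volume. -/

section TransportedMetrics

variable {E : Type*} [NormedAddCommGroup E] [NormedSpace ℂ E]
  {X : Type*} [TopologicalSpace X] [ChartedSpace E X]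

theorem topPower_pullbackFamily (b : X → E →L[ℝ] E →L[ℝ] ℝ) {N : Type*} [TopologicalSpace N]
    [ChartedSpace E N] {u : N → X} {y : N} (hu : MDifferentiableAt 𝓘(ℂ, E) 𝓘(ℂ, E) u y) :
    topPower (pullbackFamily E u b y) =
      (topPower (b (u y))).compContinuousLinearMap (mfderiv 𝓘(ℝ, E) 𝓘(ℝ, E) u y : E →L[ℝ] E) :=
  topPower_pullbackBilin (mfderiv_real_mulI hu) _

theorem injective_mfderiv_of_leftInverse {F : Type*} [NormedAddCommGroup F] [NormedSpace ℝ F]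
    {N : Type*} [TopologicalSpace N] [ChartedSpace F N] {F' : Type*} [NormedAddCommGroup F']
    [NormedSpace ℝ F'] {N' : Type*} [TopologicalSpace N'] [ChartedSpace F' N'] {u : N → N'}
    {v : N' → N} {y : N} (hu : MDifferentiableAt 𝓘(ℝ, F) 𝓘(ℝ, F') u y)
    (hv : MDifferentiableAt 𝓘(ℝ, F') 𝓘(ℝ, F) v (u y)) (h : v ∘ u =ᶠ[𝓝 y] id) :
    Function.Injective (mfderiv 𝓘(ℝ, F) 𝓘(ℝ, F') u y) := by
  have h1 := mfderiv_comp y hv hu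
  refine Function.LeftInverse.injective (g := mfderiv 𝓘(ℝ, F') 𝓘(ℝ, F) v (u y)) fun w => ?_
  have h2 := h.mfderiv_eq (I := 𝓘(ℝ, F)) (I' := 𝓘(ℝ, F))
  have h3 : (mfderiv 𝓘(ℝ, F) 𝓘(ℝ, F) (v ∘ u) y : F →L[ℝ] F) = ContinuousLinearMap.id ℝ F :=
    h2.trans mfderiv_id
  exact (DFunLike.congr_fun h1 w).symm.trans (DFunLike.congr_fun h3 w)

theorem mdifferentiable_zpow (f : X ≃ₘ^ω⟮𝓘(ℂ, E), 𝓘(ℂ, E)⟯ X) (n : ℤ) :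
    MDifferentiable 𝓘(ℂ, E) 𝓘(ℂ, E) (f.toEquiv ^ n : Equiv.Perm X) :=
  (SuspensionCover.contMDiff_zpow f n).mdifferentiable (by simp)

theorem zpow_comp_zpow (f : X ≃ₘ^ω⟮𝓘(ℂ, E), 𝓘(ℂ, E)⟯ X) (m n : ℤ) : (f.toEquiv ^ m :
    Equiv.Perm X) ∘ (f.toEquiv ^ n : Equiv.Perm X) =
    (f.toEquiv ^ (m + n) : Equiv.Perm X) := by
  rw [zpow_add, Equiv.Perm.coe_mul]

theorem injective_mfderiv_zpow (f : X ≃ₘ^ω⟮𝓘(ℂ, E), 𝓘(ℂ, E)⟯ X) (n : ℤ) (x : X) :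
    Function.Injective (mfderiv 𝓘(ℝ, E) 𝓘(ℝ, E) (f.toEquiv ^ n : Equiv.Perm X) x) := by
  refine injective_mfderiv_of_leftInverse (mdifferentiable_zpow f n x).restrictScalars_real
    (mdifferentiable_zpow f (-n) _).restrictScalars_real ?_
  rw [zpow_comp_zpow, neg_add_cancel]
  rfl

variable [IsManifold 𝓘(ℂ, E) ω X]

/-- The Riemannian metric, as a family of bilinear forms on the model space. -/
noncomputable def HermitianMetric.bilin (g : HermitianMetric E X) : X → E →L[ℝ] E →L[ℝ] ℝ :=
  g.inner

theorem HermitianMetric.isHermitianForm_bilin (g : HermitianMetric E X) (x : X) :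
    IsHermitianForm (g.bilin x) where
  symm := g.symm x
  pos := g.pos x
  map_mulI v w := by
    have h : g.bilin x (mulI E v) (mulI E (mulI E w)) = g.bilin x v (mulI E w) :=
      g.inner_tangentJ x v (tangentJ x w)
    rw [mulI_mulI, map_neg] at h
    exact neg_eq_iff_eq_neg.mp h

theorem HermitianMetric.fundamentalForm_eq (g : HermitianMetric E X) (x : X) :
    g.fundamentalForm x = fundFormCLM E (g.bilin x) :=
  ContinuousAlternatingMap.ext fun v => ((g.isHermitianForm_bilin x).fundFormCLM_apply v).symm

variable {F : Type*} [NormedAddCommGroup F] [NormedSpace ℂ F]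

theorem HermitianMetric.isHermitianForm_pullbackFamily {N : Type*} [TopologicalSpace N]
    [ChartedSpace F N] (g : HermitianMetric E X) {u : N → X} {y : N} (hu : MDifferentiableAt 𝓘(ℂ,
    F) 𝓘(ℂ, E) u y)
    (hi : Function.Injective (mfderiv 𝓘(ℝ, F) 𝓘(ℝ, E) u y)) :
    IsHermitianForm (pullbackFamily F u g.bilin y) :=
  IsHermitianForm.pullbackBilin (mfderiv_real_mulI hu) hi (g.isHermitianForm_bilin (u y))

theorem HermitianMetric.wedgePower_pullbackFamily (g : HermitianMetric E X) {u : F → X} {y : F}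
    (hu : MDifferentiableAt 𝓘(ℂ, F) 𝓘(ℂ, E) u y) (k : ℕ) :
    wedgePower (fundFormCLM F (pullbackFamily F u g.bilin y)) k =
      FormFamily.pullback (fun x => wedgePower (g.fundamentalForm x) k) u y := by
  have h {D : F →L[ℝ] E} (hD : ∀ v, D (mulI F v) = mulI E (D v)) (b : E →L[ℝ] E →L[ℝ] ℝ) :
      wedgePower (fundFormCLM F (pullbackBilin D b)) k =
        (wedgePower (fundFormCLM E b) k).compContinuousLinearMap D := by
    rw [fundFormCLM_pullbackBilin D hD, wedgePower_compContinuousLinearMap]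
  exact (h (mfderiv_real_mulI hu) _).trans
    (congrArg (fun α : E [⋀^Fin 2]→L[ℝ] ℝ => (wedgePower α k).compContinuousLinearMap
      (mfderiv 𝓘(ℝ, F) 𝓘(ℝ, E) u y : F →L[ℝ] E)) (g.fundamentalForm_eq (u y)).symm)

theorem HermitianMetric.closed_wedgePower_pullbackFamily (g : HermitianMetric E X) {k : ℕ}
    (hg : FormFamily.IsClosed fun x => wedgePower (g.fundamentalForm x) k) {u : F → X} {U : Set F}
    (hU : IsOpen U) (hu : ContMDiffOn 𝓘(ℂ, F) 𝓘(ℂ, E) ω u U) {y : F} (hy : y ∈ U) :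
    DifferentiableAt ℝ (fun y => wedgePower (fundFormCLM F (pullbackFamily F u g.bilin y)) k) y ∧
      extDeriv (fun y => wedgePower (fundFormCLM F (pullbackFamily F u g.bilin y)) k) y = 0 := by
  have hev : (fun y => wedgePower (fundFormCLM F (pullbackFamily F u g.bilin y)) k) =ᶠ[𝓝 y]
      FormFamily.pullback (fun x => wedgePower (g.fundamentalForm x) k) u := by
    filter_upwards [hU.mem_nhds hy] with z hz
    exact g.wedgePower_pullbackFamily
      ((hu.contMDiffAt (hU.mem_nhds hz)).mdifferentiableAt (by simp)) k
  obtain ⟨h1, h2⟩ := hg.pullback hU hu.restrictScalars_real hy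
  exact ⟨h1.congr_of_eventuallyEq hev, hev.extDeriv_eq.trans h2⟩

theorem HermitianMetric.topPower_pullbackFamily_of_isInvariant (g : HermitianMetric E X)
    {f : X → X} (hf : MDifferentiable 𝓘(ℂ, E) 𝓘(ℂ, E) f) (hg : g.volumeForm.IsInvariant f) (x : X) :
    topPower (pullbackFamily E f g.bilin x) = topPower (g.bilin x) := by
  have h := hg x
  have e (x : X) : g.volumeForm x = ((Module.finrank ℂ E).factorial : ℝ)⁻¹ • topPower (g.bilin x) :=
      by
    exact congrArg (fun α => ((Module.finrank ℂ E).factorial : ℝ)⁻¹ • wedgePower α _)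
      (g.fundamentalForm_eq x)
  rw [e, e] at h
  rw [topPower_pullbackFamily _ (hf x)]
  have h0 : ((Module.finrank ℂ E).factorial : ℝ)⁻¹ ≠ 0 := by positivity
  exact smul_right_injective (E [⋀^Fin (2 * Module.finrank ℂ E)]→L[ℝ] ℝ) h0 h

/-- A volume form invariant under an automorphism is invariant under its powers. -/
theorem HermitianMetric.topPower_pullbackFamily_zpow
    [FiniteDimensional ℂ E] (g : HermitianMetric E X) (f : X ≃ₘ^ω⟮𝓘(ℂ, E), 𝓘(ℂ, E)⟯ X) (hg :
        g.volumeForm.IsInvariant f) (n : ℤ) (x : X) :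
    topPower (pullbackFamily E (f.toEquiv ^ n : Equiv.Perm X) g.bilin x) =
      topPower (g.bilin x) := by
  have hd (n : ℤ) : MDifferentiable 𝓘(ℂ, E) 𝓘(ℂ, E) (f.toEquiv ^ n : Equiv.Perm X) :=
    (SuspensionCover.contMDiff_zpow f n).mdifferentiable (by simp)
  have hf : MDifferentiable 𝓘(ℂ, E) 𝓘(ℂ, E) f := f.contMDiff.mdifferentiable (by simp)
  have key (n : ℤ) (x : X) : topPower (pullbackFamily E (f.toEquiv ^ (n + 1) :
      Equiv.Perm X) g.bilin x) =
      (topPower (pullbackFamily E (f.toEquiv ^ n : Equiv.Perm X) g.bilin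
          (f x))).compContinuousLinearMap (mfderiv 𝓘(ℝ, E) 𝓘(ℝ, E) f x : E →L[ℝ] E) := by
    have h : ⇑(f.toEquiv ^ (n + 1) : Equiv.Perm X) = (f.toEquiv ^ n : Equiv.Perm X) ∘ f := by
      rw [zpow_add, zpow_one]
      rfl
    rw [h, pullbackFamily_comp _ (hd n _).restrictScalars_real (hf x).restrictScalars_real]
    exact topPower_pullbackBilin (mfderiv_real_mulI (hf x)) _
  have key0 (x : X) := (topPower_pullbackFamily g.bilin (hf x)).symm.trans
    (g.topPower_pullbackFamily_of_isInvariant hf hg x)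
  induction n generalizing x with
  | zero =>
    have h1 : (mfderiv 𝓘(ℝ, E) 𝓘(ℝ, E) (id : X → X) x : E →L[ℝ] E) =
      ContinuousLinearMap.id ℝ E := mfderiv_id
    have h2 : pullbackFamily E (id : X → X) g.bilin x = g.bilin x :=
      congrArg (fun D : E →L[ℝ] E => pullbackBilin D (g.bilin x)) h1
    exact congrArg topPower h2
  | succ n ih =>
    rw [key, ih, key0]
  | pred n ih =>
    obtain ⟨x, rfl⟩ := f.toEquiv.surjective x
    have h := key (-(n : ℤ) - 1) x
    have hi := injective_mfderiv_of_leftInverse (hf x).restrictScalars_real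
      ((f.symm.contMDiff.mdifferentiable (by simp)) _).restrictScalars_real
      (Filter.Eventually.of_forall f.symm_apply_apply)
    let D : E →L[ℝ] E := mfderiv 𝓘(ℝ, E) 𝓘(ℝ, E) f x
    -- For negative powers the pullback by the differential of f has to be cancelled. This is
    -- possible because an injective endomorphism in finite dimension is surjective.
    have hs : Function.Surjective D :=
      LinearMap.injective_iff_surjective (f := (D : E →ₗ[ℝ] E)).mp hi
    rw [sub_add_cancel, ih, ← key0 x] at h
    ext w
    choose w' hw' using fun i => hs (w i)
    obtain rfl : D ∘ w' = w := funext hw'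
    exact (congrArg (fun A => A w') h).symm

section Transported

variable (g : HermitianMetric E X) (f : X ≃ₘ^ω⟮𝓘(ℂ, E), 𝓘(ℂ, E)⟯ X)

/-- The metrics transported by the powers of an automorphism. -/
noncomputable def HermitianMetric.transport (k : ℤ) : X → E →L[ℝ] E →L[ℝ] ℝ :=
  pullbackFamily E (f.toEquiv ^ (-k) : Equiv.Perm X) g.bilin

/-- The expression of the transported metrics in the preferred chart at `a`. -/
noncomputable def HermitianMetric.transportInChart (a : X) (k : ℤ) : E → E →L[ℝ] E →L[ℝ] ℝ :=
  pullbackFamily E ((f.toEquiv ^ (-k) : Equiv.Perm X) ∘ (chartAt E a).symm) g.bilin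

theorem contMDiffOn_zpow_comp_chart_symm (n : ℤ) (a : X) :
    ContMDiffOn 𝓘(ℂ, E) 𝓘(ℂ, E) ω ((f.toEquiv ^ n : Equiv.Perm X) ∘ (chartAt E a).symm)
      (chartAt E a).target :=
  (SuspensionCover.contMDiff_zpow f n).comp_contMDiffOn contMDiffOn_chart_symm

theorem mdifferentiableAt_zpow_comp_chart_symm (n : ℤ) (a : X) {y : E}
    (hy : y ∈ (chartAt E a).target) :
    MDifferentiableAt 𝓘(ℂ, E) 𝓘(ℂ, E) ((f.toEquiv ^ n : Equiv.Perm X) ∘ (chartAt E a).symm) y :=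
  ((contMDiffOn_zpow_comp_chart_symm f n a).contMDiffAt
    ((chartAt E a).open_target.mem_nhds hy)).mdifferentiableAt (by simp)

theorem injective_mfderiv_zpow_comp_chart_symm (n : ℤ) (a : X) {y : E}
    (hy : y ∈ (chartAt E a).target) :
    Function.Injective (mfderiv 𝓘(ℝ, E) 𝓘(ℝ, E)
      ((f.toEquiv ^ n : Equiv.Perm X) ∘ (chartAt E a).symm) y) := by
  have hc : (f.toEquiv ^ (-n) : Equiv.Perm X) ∘ ((f.toEquiv ^ n : Equiv.Perm X) ∘
      (chartAt E a).symm) = (chartAt E a).symm := by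
    rw [← Function.comp_assoc, zpow_comp_zpow, neg_add_cancel]
    rfl
  refine injective_mfderiv_of_leftInverse (v := chartAt E a ∘ (f.toEquiv ^ (-n) : Equiv.Perm X))
    (mdifferentiableAt_zpow_comp_chart_symm f n a hy).restrictScalars_real ?_ ?_
  · refine MDifferentiableAt.comp _ ?_ (mdifferentiable_zpow f (-n) _).restrictScalars_real
    refine mdifferentiableAt_atlas (chart_mem_atlas E a) ?_
    change ((f.toEquiv ^ (-n) : Equiv.Perm X) ∘ ((f.toEquiv ^ n : Equiv.Perm X) ∘
        (chartAt E a).symm)) y ∈ _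
    rw [hc]
    exact (chartAt E a).map_target hy
  · rw [Function.comp_assoc, hc]
    filter_upwards [(chartAt E a).open_target.mem_nhds hy] with z hz
    exact (chartAt E a).right_inv hz

theorem HermitianMetric.isHermitianForm_transport (k : ℤ) (x : X) :
    IsHermitianForm (g.transport f k x) :=
  g.isHermitianForm_pullbackFamily (mdifferentiable_zpow f _ x) (injective_mfderiv_zpow f _ x)

variable {a : X} {y : E}

theorem HermitianMetric.isHermitianForm_transportInChart (k : ℤ) (hy : y ∈ (chartAt E a).target) :
    IsHermitianForm (g.transportInChart f a k y) :=
  g.isHermitianForm_pullbackFamily (mdifferentiableAt_zpow_comp_chart_symm f _ a hy)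
    (injective_mfderiv_zpow_comp_chart_symm f _ a hy)

/-- The change from a chart to its translate under a power of the automorphism. -/
theorem HermitianMetric.transportInChart_eq (k n : ℤ) (hy : y ∈ (chartAt E a).target) :
    g.transportInChart f a k y = pullbackBilin (F := E) (F' := E) (mfderiv 𝓘(ℝ, E) 𝓘(ℝ, E)
      ((f.toEquiv ^ n : Equiv.Perm X) ∘ (chartAt E a).symm) y) (g.transport f (k + n)
        (((f.toEquiv ^ n : Equiv.Perm X) ∘ (chartAt E a).symm) y)) := by
  rw [transport, ← pullbackFamily_comp _ (mdifferentiable_zpow f _ _).restrictScalars_real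
    (mdifferentiableAt_zpow_comp_chart_symm f n a hy).restrictScalars_real,
    ← Function.comp_assoc, zpow_comp_zpow, neg_add, neg_add_cancel_right]
  rfl

theorem HermitianMetric.closed_wedgePower_transportInChart {n : ℕ}
    (hg : FormFamily.IsClosed fun x => wedgePower (g.fundamentalForm x) n) (k : ℤ)
    (hy : y ∈ (chartAt E a).target) :
    DifferentiableAt ℝ (fun y => wedgePower (fundFormCLM E (g.transportInChart f a k y)) n) y ∧
      extDeriv (fun y => wedgePower (fundFormCLM E (g.transportInChart f a k y)) n) y = 0 :=
  g.closed_wedgePower_pullbackFamily hg (chartAt E a).open_target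
    (contMDiffOn_zpow_comp_chart_symm f (-k) a) hy

variable [FiniteDimensional ℂ E]

theorem HermitianMetric.topPower_transport (hg : g.volumeForm.IsInvariant f) (k : ℤ) (x : X) :
    topPower (g.transport f k x) = topPower (g.bilin x) :=
  g.topPower_pullbackFamily_zpow f hg _ x

theorem HermitianMetric.topPower_transportInChart (hg : g.volumeForm.IsInvariant f) (k : ℤ)
    (hy : y ∈ (chartAt E a).target) :
    topPower (g.transportInChart f a k y) = topPower (g.transportInChart f a 0 y) := by
  have h (k : ℤ) := g.transportInChart_eq f k 0 hy
  have hD := mfderiv_real_mulI (mdifferentiableAt_zpow_comp_chart_symm f 0 a hy)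
  rw [h, h]
  refine (topPower_pullbackBilin hD _).trans (Eq.trans ?_ (topPower_pullbackBilin hD _).symm)
  rw [g.topPower_transport f hg, g.topPower_transport f hg]

theorem HermitianMetric.contDiffAt_transportInChart (k : ℤ) (hy : y ∈ (chartAt E a).target) :
    ContDiffAt ℝ ∞ (g.transportInChart f a k) y :=
  (ContMDiffOn.pullbackFamily (chartAt E a).open_target
    (contMDiffOn_zpow_comp_chart_symm f (-k) a).restrictScalars_real g.contMDiff).contDiffAt
      ((chartAt E a).open_target.mem_nhds hy)

end Transported

end TransportedMetrics

/-! ### Boundedness of the unit ball of a positive form. -/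

section Bounded

variable {E : Type*} [NormedAddCommGroup E] [NormedSpace ℝ E] [FiniteDimensional ℝ E]

/-- By compactness, v ↦ b v v has a positive minimum on the unit sphere, which bounds the norm by
homogeneity. Riemannian metrics carry this condition as a field. -/
theorem isVonNBounded_of_pos [Nontrivial E] (b : E →L[ℝ] E →L[ℝ] ℝ) (hb : ∀ v, v ≠ 0 → 0 < b v v) :
    Bornology.IsVonNBounded ℝ {v : E | b v v < 1} := by
  obtain ⟨u, hu, hmin⟩ := (isCompact_sphere (0 : E) 1).exists_isMinOn
    (NormedSpace.sphere_nonempty.mpr zero_le_one)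
    (f := fun v => b v v) (b.continuous.clm_apply continuous_id).continuousOn
  have hu0 : u ≠ 0 := by
    rintro rfl
    simp at hu
  have hc := hb u hu0
  rw [NormedSpace.isVonNBounded_iff, isBounded_iff_forall_norm_le]
  refine ⟨√(1 / b u u), fun v hv => Real.le_sqrt_of_sq_le ?_⟩
  by_cases h : v = 0
  · rw [h, norm_zero, zero_pow two_ne_zero]
    positivity
  · have hv' : ‖v‖ ≠ 0 := norm_ne_zero_iff.mpr h
    have h1 : b u u ≤ b (‖v‖⁻¹ • v) (‖v‖⁻¹ • v) := hmin (by simp [norm_smul, hv'])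
    have h2 : b (‖v‖⁻¹ • v) (‖v‖⁻¹ • v) * ‖v‖ ^ 2 = b v v := by
      simp only [map_smul, smul_apply, smul_eq_mul]
      field_simp
    rw [le_div_iff₀ hc, mul_comm]
    have h3 : b v v < 1 := hv
    nlinarith [sq_nonneg ‖v‖]

end Bounded

/-! ### The charts of the suspension. -/

namespace Suspension

variable {E : Type*} [NormedAddCommGroup E] [NormedSpace ℂ E]
  {M : Type*} [TopologicalSpace M] [ChartedSpace E M]
  {f : M ≃ₘ^ω⟮𝓘(ℂ, E), 𝓘(ℂ, E)⟯ M} {τ : ℍ}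

variable (f τ) in
/-- The quotient map of the cover onto the suspension. -/
def proj : SuspensionCover f τ → Suspension f τ := Quotient.mk _

theorem surjective_proj : Function.Surjective (proj f τ) := Quotient.mk_surjective

/-- The point of the cover over which the preferred chart at a point of the suspension is defined.
-/
noncomputable def lift : Suspension f τ → SuspensionCover f τ :=
  surjective_proj.hasRightInverse.choose

theorem proj_lift (q : Suspension f τ) : proj f τ (lift q) = q :=
  surjective_proj.hasRightInverse.choose_spec q

theorem proj_vadd (γ : ℤ × ℤ) (p : SuspensionCover f τ) : proj f τ (γ +ᵥ p) = proj f τ p :=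
  Quotient.sound ⟨γ, rfl⟩

theorem exists_vadd_eq {p p' : SuspensionCover f τ} (h : proj f τ p' = proj f τ p) :
    ∃ γ : ℤ × ℤ, γ +ᵥ p = p' :=
  Quotient.exact h

theorem chartAt_apply (p p' : SuspensionCover f τ) : chartAt (E × ℂ) p p' = (chartAt E p.1 p'.1,
    p'.2) := rfl
theorem mem_chartAt_target (p : SuspensionCover f τ) (y : E × ℂ) : y ∈ (chartAt
    (E × ℂ) p).target ↔ y.1 ∈ (chartAt E p.1).target := ⟨fun h => h.1, fun h => ⟨h, trivial⟩⟩

variable [FiniteDimensional ℂ E] [T2Space M]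

variable (f τ) in
theorem isLocalHomeomorph_proj : IsLocalHomeomorph (proj f τ) :=
  isAddQuotientCoveringMap_quotientMk_of_properlyDiscontinuousVAdd.isCoveringMap.isLocalHomeomorph


/-- The tangent space at `e.symm y` is read in the preferred chart there, based at `lift (e.symm
y)`. That point and the point of the cover used by e differ by a deck transformation (m, n), which
is f^m on M times a translation of ℂ; hence the block form of the differential. -/
theorem exists_hasMFDerivAt_chart_symm [IsManifold 𝓘(ℂ, E) ω M] {e : OpenPartialHomeomorph
    (Suspension f τ) (E × ℂ)}
    (he : e ∈ atlas (E × ℂ) (Suspension f τ)) : ∃ a : M, ∀ y ∈ e.target,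
      y.1 ∈ (chartAt E a).target ∧ ∃ m n : ℤ,
        (lift (e.symm y)).1 = ((f.toEquiv ^ m : Equiv.Perm M) ∘ (chartAt E a).symm) y.1 ∧
        (lift (e.symm y)).2 = y.2 + m + n * (τ : ℂ) ∧
        HasMFDerivAt 𝓘(ℂ, E × ℂ) 𝓘(ℂ, E × ℂ) e.symm y
          (((mfderiv 𝓘(ℂ, E) 𝓘(ℂ, E) ((f.toEquiv ^ m : Equiv.Perm M) ∘ (chartAt E a).symm) y.1 :
            E →L[ℂ] E).prodMap (ContinuousLinearMap.id ℂ ℂ) : E × ℂ →L[ℂ] E × ℂ)) := by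
  set hloc := isLocalHomeomorph_proj f τ
  obtain ⟨p, hp⟩ : ∃ p, e = (hloc.localInverseAt p).trans (chartAt (E × ℂ) p) := by
    obtain ⟨q, rfl⟩ := he
    exact ⟨_, rfl⟩
  refine ⟨p.1, fun y hy => ?_⟩
  have hy1 : y ∈ (chartAt (E × ℂ) p).target := by
    rw [hp] at hy
    exact hy.1
  have hy1' : y.1 ∈ (chartAt E p.1).target := (mem_chartAt_target p y).mp hy1
  have hs (p p' : SuspensionCover f τ) : (hloc.localInverseAt p).symm p' = proj f τ p' :=
    congrFun (hloc.localInverseAt_symm p) p'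
  set φ := (chartAt (E × ℂ) p).symm with hφ
  have hsymm (z : E × ℂ) : e.symm z = proj f τ (φ z) := by
    rw [hp]
    exact hs p _
  set q := e.symm y with hq
  obtain ⟨γ, hγ⟩ : ∃ γ : ℤ × ℤ, γ +ᵥ φ y = lift q :=
    exists_vadd_eq (by rw [proj_lift, hq, hsymm])
  have hγ1 : (lift q).1 = ((f.toEquiv ^ γ.1 : Equiv.Perm M) ∘ (chartAt E p.1).symm) y.1 := by
    rw [← hγ]
    rfl
  refine ⟨hy1', γ.1, γ.2, hγ1, ?_, e.continuousAt_symm hy, ?_⟩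
  · rw [← hγ]
    rfl
  set L := hloc.localInverseAt (lift q) with hL
  -- Near y one and the same γ relates the two local inverses, although `lift` itself need not be
  -- continuous.
  have key : ∀ᶠ z in 𝓝 y, L (proj f τ (φ z)) = γ +ᵥ φ z := by
    have hc : ContinuousAt (fun z => γ +ᵥ φ z) y :=
      (continuous_const_vadd γ).continuousAt.comp ((chartAt (E × ℂ) p).continuousAt_symm hy1)
    have hmem : L.target ∈ 𝓝 (γ +ᵥ φ y) := by
      rw [hγ]
      exact L.open_target.mem_nhds hloc.self_mem_localInverseAt_target
    filter_upwards [hc hmem] with z hz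
    rw [← proj_vadd γ, ← hs]
    exact L.right_inv hz
  let u : E → M := (f.toEquiv ^ γ.1 : Equiv.Perm M) ∘ (chartAt E p.1).symm
  let A : E →L[ℂ] E := mfderiv 𝓘(ℂ, E) 𝓘(ℂ, E) u y.1
  have hu : HasFDerivAt (𝕜 := ℂ) (E := E) (F := E) (chartAt E (u y.1) ∘ u) A y.1 := by
    have h : HasFDerivWithinAt (𝕜 := ℂ) (E := E) (F := E) (chartAt E (u y.1) ∘ u) A
        (Set.range 𝓘(ℂ, E)) y.1 :=
      (mdifferentiableAt_zpow_comp_chart_symm f γ.1 p.1 hy1').hasMFDerivAt.2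
    rwa [ModelWithCorners.range_eq_univ, hasFDerivWithinAt_univ] at h
  have hmain : HasFDerivAt (𝕜 := ℂ)
      (fun z : E × ℂ => ((chartAt E (u y.1) ∘ u) z.1, z.2 + γ.1 + γ.2 * (τ : ℂ)))
      (A.prodMap (ContinuousLinearMap.id ℂ ℂ)) y :=
    (hu.comp y hasFDerivAt_fst).prodMk ((hasFDerivAt_snd.add_const _).add_const _)
  refine HasFDerivAt.hasFDerivWithinAt (hmain.congr_of_eventuallyEq ?_)
  filter_upwards [key] with z hz
  change chartAt (E × ℂ) (lift q) (L (e.symm z)) = _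
  rw [hsymm, hz, chartAt_apply, hγ1]
  rfl

end Suspension

/-! ### The balanced metric on the suspension. -/

namespace Suspension

variable {E : Type*} [NormedAddCommGroup E] [NormedSpace ℂ E]

variable (E) in
/-- The first projection, as a real linear map. -/
noncomputable def fstCLM : E × ℂ →L[ℝ] E := (ContinuousLinearMap.fst ℂ E ℂ).restrictScalars ℝ

variable (E) in
/-- The second projection, as a real linear map. -/
noncomputable def sndCLM : E × ℂ →L[ℝ] ℂ := (ContinuousLinearMap.snd ℂ E ℂ).restrictScalars ℝ

theorem fstCLM_mulI (v : E × ℂ) : fstCLM E (mulI (E × ℂ) v) = mulI E (fstCLM E v) := rfl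

theorem sndCLM_mulI (v : E × ℂ) : sndCLM E (mulI (E × ℂ) v) = mulI ℂ (sndCLM E v) := rfl

theorem eq_zero_of_fstCLM_of_sndCLM (v : E × ℂ) (h1 : fstCLM E v = 0) (h2 : sndCLM E v = 0) :
    v = 0 := Prod.ext h1 h2

variable {M : Type*} [TopologicalSpace M] [ChartedSpace E M] [IsManifold 𝓘(ℂ, E) ω M]
  {f : M ≃ₘ^ω⟮𝓘(ℂ, E), 𝓘(ℂ, E)⟯ M} {τ : ℍ}

/-- The coordinate of the complex plane which is invariant under the translation by `τ` and
increases by one under the translation by one. -/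
noncomputable def time (τ : ℍ) (z : ℂ) : ℝ := shearCLM (τ.re / τ.im) z

theorem time_add (z : ℂ) (m n : ℤ) : time τ (z + m + n * (τ : ℂ)) = time τ z + m := by
  have := τ.im_ne_zero
  rw [time, time, shearCLM_apply, shearCLM_apply]
  simp
  field_simp
  ring

variable [FiniteDimensional ℂ E] (g : HermitianMetric E M)

/-- The metric of the suspension, as a family of bilinear forms on the model space. -/
noncomputable def bilin (q : Suspension f τ) : (E × ℂ) →L[ℝ] (E × ℂ) →L[ℝ] ℝ :=
  -- No differential of a chart enters, because the model space represents the tangent space at q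
  -- through the chart based at `lift q`.
  sectionForm (fstCLM E) (sndCLM E) (time τ (lift q).2) fun k => g.transport f k (lift q).1

theorem isHermitianForm_bilin (q : Suspension f τ) : IsHermitianForm (bilin g q) :=
  isHermitianForm_sectionForm fstCLM_mulI sndCLM_mulI eq_zero_of_fstCLM_of_sndCLM _
    fun k => g.isHermitianForm_transport f k _

variable [T2Space M]

/-- The metric of the suspension in a chart. -/
theorem exists_pullbackFamily_chart_symm_bilin (hg : g.volumeForm.IsInvariant f)
    {e : OpenPartialHomeomorph (Suspension f τ) (E × ℂ)}
    (he : e ∈ atlas (E × ℂ) (Suspension f τ)) : ∃ a : M, ∀ y ∈ e.target,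
      y.1 ∈ (chartAt E a).target ∧ pullbackFamily (E × ℂ) e.symm (bilin g) y =
        sectionForm (fstCLM E) (sndCLM E) (time τ (sndCLM E y))
          fun k => g.transportInChart f a k (fstCLM E y) := by
  obtain ⟨a, ha⟩ := exists_hasMFDerivAt_chart_symm he
  refine ⟨a, fun y hy => ?_⟩
  obtain ⟨hy', m, n, h1, h2, h3⟩ := ha y hy
  refine ⟨hy', ?_⟩
  set u : E → M := (f.toEquiv ^ m : Equiv.Perm M) ∘ (chartAt E a).symm with hu
  let A : E →L[ℂ] E := mfderiv 𝓘(ℂ, E) 𝓘(ℂ, E) u y.1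
  have hA : mfderiv 𝓘(ℝ, E) 𝓘(ℝ, E) u y.1 = A.restrictScalars ℝ :=
    (HasMFDerivAt.restrictScalars_real
      (mdifferentiableAt_zpow_comp_chart_symm f m a hy').hasMFDerivAt).mfderiv
  have hinj : Function.Injective (A.restrictScalars ℝ) :=
    hA ▸ injective_mfderiv_zpow_comp_chart_symm f m a hy'
  obtain ⟨D, hD⟩ := ContinuousLinearMap.isInvertible_of_injective rfl hinj
  let P : E × ℂ →L[ℝ] E × ℂ := (A.prodMap (ContinuousLinearMap.id ℂ ℂ)).restrictScalars ℝ
  have hP : pullbackFamily (E × ℂ) e.symm (bilin g) y = pullbackBilin P (bilin g (e.symm y)) :=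
    congrArg (fun P' : E × ℂ →L[ℝ] E × ℂ => pullbackBilin P' (bilin g (e.symm y)))
      (HasMFDerivAt.restrictScalars_real h3).mfderiv
  rw [hP, bilin, h1, h2, time_add]
  -- The integer m depends on the choice made by `lift` and may jump with y. Equivariance absorbs it
  -- into a shift of time and index, leaving an expression that is smooth in y.
  refine pullbackBilin_sectionForm (D := D) (fun v => ?_) (fun v => ?_) (fun v => rfl) (fun i => ?_)
    (g.isHermitianForm_transport f m _) (fun i => ?_) _
  · have h (v : E) : D v = A v := DFunLike.congr_fun hD v
    rw [h, h]
    exact map_smul A Complex.I v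
  · exact (DFunLike.congr_fun hD (fstCLM E v)).symm
  · rw [hD]
    refine (g.transportInChart_eq f i m hy').trans ?_
    exact congrArg (fun D' : E →L[ℝ] E => pullbackBilin D' (g.transport f (i + m) (u y.1))) hA
  · rw [g.topPower_transport f hg, g.topPower_transport f hg]

theorem contMDiff_time {X : Type*} [NormedAddCommGroup X] [NormedSpace ℝ X] (q : X →L[ℝ] ℂ) :
    ContDiff ℝ ∞ fun y => time τ (q y) :=
  (shearCLM (τ.re / τ.im) ∘L q).contDiff

/-- The Hermitian metric of the suspension. -/
noncomputable def hermitianMetric (hg : g.volumeForm.IsInvariant f) :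
    HermitianMetric (E × ℂ) (Suspension f τ) where
  inner := bilin g
  symm q := (isHermitianForm_bilin g q).symm
  pos q := (isHermitianForm_bilin g q).pos
  isVonNBounded q := isVonNBounded_of_pos (bilin g q) (isHermitianForm_bilin g q).pos
  contMDiff q := by
    refine contMDiffAt_of_pullbackFamily ?_
    obtain ⟨a, ha⟩ := exists_pullbackFamily_chart_symm_bilin g hg (chart_mem_atlas (E × ℂ) q)
    have hy := mem_chart_target (E × ℂ) q
    refine ContDiffAt.congr_of_eventuallyEq ?_ (Filter.eventuallyEq_of_mem
      ((chartAt (E × ℂ) q).open_target.mem_nhds hy) fun y hy => (ha y hy).2)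
    have hy' := (ha _ hy).1
    refine ContDiffAt.sectionForm (contMDiff_time _).contDiffAt (fun k => ?_)
      fun k => g.isHermitianForm_transportInChart f k hy'
    exact (g.contDiffAt_transportInChart f k hy').comp _ (fstCLM E).contDiff.contDiffAt
  inner_tangentJ q v w := (isHermitianForm_bilin g q).map_mulI_mulI v w

theorem isBalanced_hermitianMetric (hg : g.volumeForm.IsInvariant f) (hb : g.IsBalanced) :
    (hermitianMetric g hg : HermitianMetric (E × ℂ) (Suspension f τ)).IsBalanced := by
  have hrank : Module.finrank ℂ (E × ℂ) - 1 = Module.finrank ℂ E := by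
    rw [Module.finrank_prod, Module.finrank_self, Nat.add_sub_cancel]
  -- The exponent occurs in the type of the forms, so it is made a variable that can be replaced by
  -- 0 or k + 1.
  have main (n : ℕ) (hn : n = Module.finrank ℂ E) : FormFamily.IsClosed fun q : Suspension f τ =>
      wedgePower ((hermitianMetric g hg).fundamentalForm q) n := by
    intro e he
    obtain ⟨a, ha⟩ := exists_pullbackFamily_chart_symm_bilin g hg he
    let H : E × ℂ → (E × ℂ) [⋀^Fin (2 * n)]→L[ℝ] ℝ := fun y =>
      wedgePower (fundFormCLM (E × ℂ) (sectionForm (fstCLM E) (sndCLM E) (time τ (sndCLM E y))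
        fun k => g.transportInChart f a k (fstCLM E y))) n
    have hH (y : E × ℂ) (hy : y ∈ e.target) : FormFamily.inChart (fun q : Suspension f τ =>
        wedgePower ((hermitianMetric g hg).fundamentalForm q) n) e y = H y := by
      have h := (hermitianMetric (τ := τ) g hg).wedgePower_pullbackFamily
        (mdifferentiableAt_atlas_symm he hy) n
      refine h.symm.trans ?_
      exact congrArg (fun b => wedgePower (fundFormCLM (E × ℂ) b) n) (ha y hy).2
    have hcl (y : E × ℂ) (hy : y ∈ e.target) : DifferentiableAt ℝ H y ∧ extDeriv H y = 0 := by
      -- If M has dimension 0, the form is the constant 1. Otherwise the truncated difference m - 1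
      -- is the true one, and the hypothesis on g concerns the power k with m = k + 1.
      rcases Nat.eq_zero_or_pos n with rfl | hpos
      · have h : H = fun _ => H y := by
          ext z v
          exact (wedgePower_zero _ v).trans (wedgePower_zero _ v).symm
        rw [h]
        refine ⟨differentiableAt_const _, ?_⟩
        rw [extDeriv, fderiv_fun_const]
        exact map_zero (ContinuousAlternatingMap.alternatizeUncurryFinCLM ℝ (E × ℂ) ℝ)
      · obtain ⟨k, rfl⟩ := Nat.exists_eq_add_one.mpr hpos
        have hk : Module.finrank ℂ E - 1 = k := by omega
        have hb' : FormFamily.IsClosed fun x => wedgePower (g.fundamentalForm x) k := hk ▸ hb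
        exact closed_wedgePower_sectionForm fstCLM_mulI sndCLM_mulI eq_zero_of_fstCLM_of_sndCLM _
          hn.symm (chartAt E a).open_target
          (fun i y hy => g.isHermitianForm_transportInChart f i hy)
          (fun i y hy => g.topPower_transportInChart f hg i hy)
          (fun y hy => (g.contDiffAt_transportInChart f 0 hy).differentiableAt (by simp))
          (fun i y hy => g.closed_wedgePower_transportInChart f hb' i hy) (ha y hy).1
    refine ⟨fun y hy => ?_, fun y hy => ?_⟩
    · exact ((hcl y hy).1.congr_of_eventuallyEq (Filter.eventuallyEq_of_mem
        (e.open_target.mem_nhds hy) hH)).differentiableWithinAt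
    · exact (Filter.eventuallyEq_of_mem (e.open_target.mem_nhds hy) hH).extDeriv_eq.trans
        (hcl y hy).2
  exact main _ hrank

end Suspension

theorem mainTheorem2 {E : Type*} [NormedAddCommGroup E] [NormedSpace ℂ E] [FiniteDimensional ℂ E]
    {M : Type*} [TopologicalSpace M] [T2Space M] [ChartedSpace E M] [IsManifold 𝓘(ℂ, E) ω M]
    (f : M ≃ₘ^ω⟮𝓘(ℂ, E), 𝓘(ℂ, E)⟯ M) (τ : ℍ)
    (h : ∃ g : HermitianMetric E M, g.IsBalanced ∧ g.volumeForm.IsInvariant f) :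
    ∃ g : HermitianMetric (E × ℂ) (Suspension f τ), g.IsBalanced := by
  obtain ⟨g, hb, hg⟩ := h
  exact ⟨Suspension.hermitianMetric g hg, Suspension.isBalanced_hermitianMetric g hg hb⟩
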